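/- All spaces are Hausdorff and all maps are continuous. $\mathbb{L}_{\ge 0}$ is the closed long ray $\omega_1\times[0,1)$ with the lexicographic order topology, and $\alpha\in\omega_1$ is identified with $\langle\alpha,0\rangle\in\mathbb{L}_{\ge0}$. A space $X$ is of Type I if it is not Lindelöf and $X=\bigcup_{\alpha<\omega_1}X_\alpha$ with $X_\alpha$ open, $\overline{X_\alpha}$ Lindelöf, and $\overline{X_\alpha}\subset X_\beta$ for $\alpha<\beta$. The sequence $\langle X_\alpha\rangle$ is canonical if $X_0=\varnothing$ and $X_\alpha=\bigcup_{\beta<\alpha}X_\beta$ for limit $\alpha$. A subset of $X$ is bounded if it is contained in some $X_\alpha$ (this does not depend on the sequence), and club if it is closed and unbounded. A club $D\subset X$ is a direction in $X$ if for every club $C$ of $X$ with $C\subset D$ and every $f:X\to\mathbb{L}_{\ge0}$, $f$ is unbounded on $D$ if and only if it is unbounded on $C$; $X$ is a direction in itself if $D=X$ is a direction in $X$. A club $C$ of $X$ contains no direction in itself if no club $D$ of $X$ with $D\subset C$, with its subspace topology, is a direction in itself. A space is $\omega$-bounded if every countable subset has compact closure, and $\omega_1$-compact if it has no uncountable closed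 discrete subset. A slicer of $X$ (with canonical sequence $\langle X_\alpha\rangle$) is a map $s:X\to\mathbb{L}_{\ge0}$ with $s(\overline{X_{\alpha+1}}-X_\alpha)\subset[\alpha,\alpha+1]$ for all $\alpha<\omega_1$. Then $\Sigma(X,s)$ is the set $(X\times[0,1))\sqcup\mathbb{L}_{\ge0}$, where $X\times[0,1)$ is open with its product topology, and a neighborhood base at $x\in\mathbb{L}_{\ge0}$ is given by the sets $V\sqcup\big(s^{-1}(V)\times(a,1)\big)$ with $V$ an open interval of $\mathbb{L}_{\ge0}$ around $x$ and $0\le a<1$. **Theorem.** (a) There is an $\omega$-bounded Type I space which is a direction in itself and which has a club subset containing no direction in itself. (b) If the Suslin hypothesis fails, i.e. if there is a Suslin tree, then there is a Type I, locally metrizable, locally separable, $\omega_1$-compact space which is a direction in itself and which has a club subset containing no direction in itself. (c) Assume Nyikos' (announced, unpublished) claim that $\diamondsuit^+$ implies the existence of an $\omega$-bounded Type I surface containing no direction. Then $\diamondsuit^+$ implies that there is an $\omega$-bounded space with all the properties listed in (b). In each of (a), (b), (c) the space can moreover be taken of the form $\Sigma(X,s)$ for some Type I space $X$ with a slicer $s$.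 -/

import Mathlib

open Set Topology

/-- The set `ω₁` of countable ordinals, as a well-ordered type. -/
abbrev Omega1 : Type := (Ordinal.omega.{0} 1).ToType

/-! ### The closed long ray -/

/-- The closed long ray: `ω₁ × [0, 1)` with the lexicographic order (and its order topology). -/
def LongRay : Type := Omega1 ×ₗ Set.Ico (0 : ℝ) 1

noncomputable instance : LinearOrder LongRay :=
  inferInstanceAs (LinearOrder (Omega1 ×ₗ Set.Ico (0 : ℝ) 1))

noncomputable instance : TopologicalSpace LongRay := Preorder.topology LongRay

instance : OrderTopology LongRay := ⟨rfl⟩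

/-- The copy of `ω₁` in the long ray: `α` is identified with `⟨α, 0⟩`. -/
def LongRay.ofOmega1 (α : Omega1) : LongRay :=
  (toLex (α, ⟨0, by norm_num⟩) : Omega1 ×ₗ Set.Ico (0 : ℝ) 1)

/-! ### Type I spaces -/

/-- `⟨U α : α < ω₁⟩` witnesses that `X` is of Type I: it covers `X`, each `U α` is open with
Lindelöf closure, and `closure (U α) ⊆ U β` whenever `α < β`. -/
structure IsTypeISeq {X : Type*} [TopologicalSpace X] (U : Omega1 → Set X) : Prop where
  iUnion_eq : ⋃ α, U α = univ
  isOpen : ∀ α, IsOpen (U α)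
  isLindelof_closure : ∀ α, IsLindelof (closure (U α))
  closure_subset : ∀ α β, α < β → closure (U α) ⊆ U β

/-- Type I spaces. All spaces are Hausdorff, and Type I spaces are required not to be Lindelöf. -/
structure IsTypeI (X : Type*) [TopologicalSpace X] : Prop where
  t2 : T2Space X
  not_lindelof : ¬ LindelofSpace X
  exists_seq : ∃ U : Omega1 → Set X, IsTypeISeq U

/-- A subset of a Type I space is bounded if it is contained in some member of a sequence
witnessing Type I. This does not depend on the sequence, see `isBoundedSet_iff`. -/
def IsBoundedSet {X : Type*} [TopologicalSpace X] (A : Set X) : Prop :=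
  ∃ U : Omega1 → Set X, IsTypeISeq U ∧ ∃ α, A ⊆ U α

/-- Countable subsets of `ω₁` are bounded. -/
theorem exists_upper_of_countable {S : Set Omega1} (hS : S.Countable) :
    ∃ β : Omega1, ∀ α ∈ S, α < β := by
  have h1 : ∀ α : Omega1, ((Ordinal.ToType.toOrd α : Set.Iio _) : Ordinal.{0}) < Ordinal.omega 1 :=
    fun α => (Ordinal.ToType.toOrd α).2
  have : Countable S := hS.to_subtype
  have hlt : (⨆ i : S, ((Ordinal.ToType.toOrd i.1 : Set.Iio _) : Ordinal.{0}))
      < Ordinal.omega 1 := Ordinal.iSup_lt_omega_one fun i => h1 i.1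
  have hlim := (Cardinal.isSuccLimit_omega 1).succ_lt hlt
  refine ⟨Ordinal.ToType.mk ⟨_, hlim⟩, fun α hα => ?_⟩
  rw [← Ordinal.ToType.mk.symm.lt_iff_lt, OrderIso.symm_apply_apply]
  refine Subtype.coe_lt_coe.1 (Order.lt_succ_of_le ?_)
  exact le_ciSup (f := fun i : S => ((Ordinal.ToType.toOrd i.1 : Set.Iio _) : Ordinal.{0}))
    ⟨Ordinal.omega 1, by rintro _ ⟨i, rfl⟩; exact (h1 i.1).le⟩ ⟨α, hα⟩

/-- Boundedness can be computed with any sequence witnessing Type I. -/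
theorem isBoundedSet_iff {X : Type*} [TopologicalSpace X] {V : Omega1 → Set X}
    (hV : IsTypeISeq V) (A : Set X) : IsBoundedSet A ↔ ∃ α, A ⊆ V α := by
  refine ⟨?_, fun ⟨α, h⟩ => ⟨V, hV, α, h⟩⟩
  rintro ⟨U, hU, α, hA⟩
  obtain ⟨t, ht, hsub⟩ := (hU.isLindelof_closure α).elim_countable_subcover V hV.isOpen
    (by rw [hV.iUnion_eq]; exact subset_univ _)
  obtain ⟨β, hβ⟩ := exists_upper_of_countable ht
  refine ⟨β, fun x hx => ?_⟩
  obtain ⟨γ, hγ, hxγ⟩ := mem_iUnion₂.1 (hsub (subset_closure (hA hx)))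
  exact hV.closure_subset γ β (hβ γ hγ) (subset_closure hxγ)

/-- Closed and unbounded subsets of a Type I space. -/
def IsClubSubset {X : Type*} [TopologicalSpace X] (C : Set X) : Prop :=
  IsClosed C ∧ ¬ IsBoundedSet C

/-! ### Directions -/

/-- The unbounded function order: every continuous map to the long ray which is unbounded on `A`
is unbounded on `B`. (A subset of the long ray is bounded iff it has an upper bound.) -/
def UfoLE {X : Type*} [TopologicalSpace X] (A B : Set X) : Prop :=
  ∀ f : X → LongRay, Continuous f → ¬ BddAbove (f '' A) → ¬ BddAbove (f '' B)

/-- Equivalence for the unbounded function order. -/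
def UfoEquiv {X : Type*} [TopologicalSpace X] (A B : Set X) : Prop :=
  UfoLE A B ∧ UfoLE B A

/-- A direction in `X`: a club subset which is ufo-equivalent to each of its club subsets. -/
def IsDirection {X : Type*} [TopologicalSpace X] (D : Set X) : Prop :=
  IsClubSubset D ∧ ∀ C : Set X, C ⊆ D → IsClubSubset C → UfoEquiv D C

/-- The (Type I) space `X` is a direction in itself. -/
def IsDirectionInItself (X : Type*) [TopologicalSpace X] : Prop :=
  IsDirection (univ : Set X)

/-- `C` contains no direction in itself: no club subset `D ⊆ C` is, as a space in its own right
(with the subspace topology), a direction in itself. -/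
def ContainsNoDirectionInItself {X : Type*} [TopologicalSpace X] (C : Set X) : Prop :=
  ∀ D : Set X, D ⊆ C → IsClubSubset D → ¬ IsDirectionInItself D

/-- The space `X` contains no direction. -/
def ContainsNoDirection (X : Type*) [TopologicalSpace X] : Prop :=
  ∀ D : Set X, ¬ IsDirection D

/-! ### Topological properties -/

/-- The closure of every countable subset is compact. -/
def IsOmegaBounded (X : Type*) [TopologicalSpace X] : Prop :=
  ∀ A : Set X, A.Countable → IsCompact (closure A)

/-- There is no uncountable closed discrete subset. -/
def IsOmega1Compact (X : Type*) [TopologicalSpace X] : Prop :=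
  ∀ D : Set X, IsClosed D → DiscreteTopology D → D.Countable

/-- Every point has an open neighborhood which is metrizable. -/
def IsLocallyMetrizable (X : Type*) [TopologicalSpace X] : Prop :=
  ∀ x : X, ∃ U : Set X, IsOpen U ∧ x ∈ U ∧ TopologicalSpace.MetrizableSpace U

/-- Every point has an open neighborhood which is separable. -/
def IsLocallySeparable (X : Type*) [TopologicalSpace X] : Prop :=
  ∀ x : X, ∃ U : Set X, IsOpen U ∧ x ∈ U ∧ TopologicalSpace.SeparableSpace U

/-- A surface: a connected Hausdorff space each of whose points has an open neighborhood
homeomorphic to the plane. -/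
structure IsSurface (X : Type*) [TopologicalSpace X] : Prop where
  t2 : T2Space X
  connected : ConnectedSpace X
  locally_plane : ∀ x : X, ∃ U : Set X, IsOpen U ∧ x ∈ U ∧
    Nonempty (U ≃ₜ EuclideanSpace ℝ (Fin 2))

/-! ### Slicers and the spaces `Σ(X, s)` -/

/-- A canonical sequence: a sequence witnessing Type I with `U α = ⋃ β < α, U β` for each limit
`α`, and `U 0 = ∅` (which is the same equation for `α = 0`). -/
structure IsCanonicalSeq {X : Type*} [TopologicalSpace X] (U : Omega1 → Set X) : Prop where
  isTypeISeq : IsTypeISeq U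
  eq_iUnion : ∀ α, Order.IsSuccPrelimit α → U α = ⋃ β, ⋃ (_ : β < α), U β

/-- A slicer for the canonical sequence `U`: a continuous map to the long ray which sends
`closure (U (α + 1)) \ U α` into `[α, α + 1]`. -/
structure IsSlicer {X : Type*} [TopologicalSpace X] (U : Omega1 → Set X) (s : X → LongRay) :
    Prop where
  continuous : Continuous s
  mem_Icc : ∀ α, ∀ x ∈ closure (U (Order.succ α)) \ U α,
    s x ∈ Icc (LongRay.ofOmega1 α) (LongRay.ofOmega1 (Order.succ α))

/-- The underlying set of `Σ(X, s)`: the disjoint union of `X × [0, 1)` and of the long ray. -/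
def SigmaSpace {X : Type*} (_s : X → LongRay) : Type _ :=
  (X × Set.Ico (0 : ℝ) 1) ⊕ LongRay

namespace SigmaSpace

variable {X : Type*} {s : X → LongRay}

/-- The inclusion of `X × [0, 1)`. -/
def body (p : X × Set.Ico (0 : ℝ) 1) : SigmaSpace s := Sum.inl p

/-- The inclusion of the core, a copy of the long ray. -/
def core (x : LongRay) : SigmaSpace s := Sum.inr x

/-- The set `W(V, a)`, the union of `V` (in the core) and of `s⁻¹(V) × (a, 1)`. -/
def coreNhd (s : X → LongRay) (V : Set LongRay) (a : ℝ) : Set (SigmaSpace s) :=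
  core '' V ∪ body '' {p | s p.1 ∈ V ∧ a < (p.2 : ℝ)}

/-- The topology of `Σ(X, s)`: the points of `X × [0, 1)` have their usual neighborhoods (and
`X × [0, 1)` is open), and a neighborhood base at a point `x` of the core is given by the sets
`W(V, a)` with `V` an open neighborhood of `x` (equivalently an open interval around `x`)
and `a < 1`. -/
instance [TopologicalSpace X] : TopologicalSpace (SigmaSpace s) where
  IsOpen G := IsOpen (body ⁻¹' G : Set (X × Set.Ico (0 : ℝ) 1)) ∧
    ∀ x : LongRay, core x ∈ G →
      ∃ V : Set LongRay, IsOpen V ∧ x ∈ V ∧ ∃ a : ℝ, 0 ≤ a ∧ a < 1 ∧ coreNhd s V a ⊆ G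
  isOpen_univ := ⟨by simp, fun x _ => ⟨univ, isOpen_univ, mem_univ x, 0, le_rfl, one_pos,
    subset_univ _⟩⟩
  isOpen_inter := by
    rintro G H ⟨hG, hG'⟩ ⟨hH, hH'⟩
    refine ⟨hG.inter hH, fun x hx => ?_⟩
    obtain ⟨V, hV, hxV, a, ha0, ha1, hVa⟩ := hG' x hx.1
    obtain ⟨W, hW, hxW, b, hb0, hb1, hWb⟩ := hH' x hx.2
    refine ⟨V ∩ W, hV.inter hW, ⟨hxV, hxW⟩, max a b, le_max_of_le_left ha0, max_lt ha1 hb1, ?_⟩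
    rintro _ (⟨y, hy, rfl⟩ | ⟨p, ⟨hp, hap⟩, rfl⟩)
    · exact ⟨hVa (Or.inl ⟨y, hy.1, rfl⟩), hWb (Or.inl ⟨y, hy.2, rfl⟩)⟩
    · exact ⟨hVa (Or.inr ⟨p, ⟨hp.1, (le_max_left a b).trans_lt hap⟩, rfl⟩),
        hWb (Or.inr ⟨p, ⟨hp.2, (le_max_right a b).trans_lt hap⟩, rfl⟩)⟩
  isOpen_sUnion := by
    intro S hS
    refine ⟨?_, ?_⟩
    · rw [preimage_sUnion]
      exact isOpen_biUnion fun G hG => (hS G hG).1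
    · rintro x ⟨G, hG, hx⟩
      obtain ⟨V, hV, hxV, a, ha0, ha1, hVa⟩ := (hS G hG).2 x hx
      exact ⟨V, hV, hxV, a, ha0, ha1, hVa.trans (subset_sUnion_of_mem hG)⟩

end SigmaSpace

/-! ### Set-theoretic hypotheses -/

/-- A Suslin tree: an uncountable partial order in which the predecessors of each element are
well-ordered, and all of whose chains and antichains are countable. -/
structure IsSuslinTree (T : Type*) [PartialOrder T] : Prop where
  chain_Iio : ∀ t : T, IsChain (· ≤ ·) (Iio t)
  wf_Iio : ∀ t : T, (Iio t).IsWF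
  uncountable : Uncountable T
  chain_countable : ∀ C : Set T, IsChain (· ≤ ·) C → C.Countable
  antichain_countable : ∀ A : Set T, IsAntichain (· ≤ ·) A → A.Countable

/-- The Suslin hypothesis SH: there is no Suslin tree. -/
def SuslinHypothesis : Prop :=
  ¬ ∃ (T : Type) (_ : PartialOrder T), IsSuslinTree T

/-- The principle `◇⁺`: there are countable families `𝒜 α` of subsets of `α`, for `α < ω₁`, such
that each `A ⊆ ω₁` admits a club `C ⊆ ω₁` with `A ∩ α ∈ 𝒜 α` and `C ∩ α ∈ 𝒜 α` for all
`α ∈ C`. -/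
def DiamondPlus : Prop :=
  ∃ 𝒜 : Omega1 → Set (Set Omega1),
    (∀ α, (𝒜 α).Countable ∧ ∀ A ∈ 𝒜 α, A ⊆ Iio α) ∧
    ∀ A : Set Omega1, ∃ C : Set Omega1, IsClub C ∧
      ∀ α ∈ C, A ∩ Iio α ∈ 𝒜 α ∧ C ∩ Iio α ∈ 𝒜 α

/-- Nyikos' claim: `◇⁺` implies that there is an `ω`-bounded Type I surface which contains
no direction. -/
def NyikosClaim : Prop :=
  DiamondPlus → ∃ (N : Type) (_ : TopologicalSpace N),
    IsSurface N ∧ IsTypeI N ∧ IsOmegaBounded N ∧ ContainsNoDirection N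

/-! ### Countable ordinals -/

namespace Omega1

/-! `Σ(X, s)` is the cylinder `X × [0, 1]` with its top collapsed onto the long ray along `s`
(`SigmaSpace.cyl`). A map `f` from it to the long ray is therefore a homotopy on `X` whose value at
time 1 factors through `s` and the core. On the core, `f` is a self-map of the long ray; two closed
unbounded subsets of the ray meet, so this self-map is bounded or proper
(`LongRay.bddAbove_preimage_Iic`). Call `X` rigid (`HomotopyRigid`) if a homotopy into the ray which
is bounded, respectively proper, at time 1 is so uniformly in all times. If `X` is rigid, every `f`
is bounded or has bounded preimages of bounded sets. In the second case it is unbounded on each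
club, so `Σ(X, s)` is a direction in itself.

The bottom `X × {0}` is a closed copy of `X`. If `X` contains no direction, each club `D` of `X` has
a club `C ⊆ D` and a map on `X` that is unbounded on `D` and bounded on `C`. Its restriction to `D`
shows that `D` is not a direction in itself. It remains to find rigid spaces with a slicer and
without directions.

Countably compact spaces are rigid, by bisection of the time interval (`IsOscillating.false`). This
covers (a), where `X` consists of the ultrafilters on `ω₁` containing a countable set: an unbounded
subset contains ultrafilters concentrating on disjoint intervals, and a clopen set splits it into
two unbounded pieces. It also covers (c), with `X` the given surface and a slicer built from Urysohn
functions.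

For (b), `X` is a pruned Hausdorff Suslin tree with the tree topology. Since antichains are
countable, an upwards closed property is decided at a countable level (`exists_forall_mem`), an
unbounded set is dense above some node, and countably many closed sets dense above a node share a
whole level of its cone (`exists_level_subset`). Two disjoint cones then split any club. For
rigidity, a high enough node decides, for countably many times at once, whether a homotopy is
bounded or proper on its cone, and connectedness of `[0, 1]` makes all times agree. -/

instance : NoMaxOrder Omega1 :=
  ⟨fun a => (exists_upper_of_countable (countable_singleton a)).imp fun _ h => h a rfl⟩

instance : Nonempty Omega1 :=
  (exists_upper_of_countable countable_empty).nonempty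

theorem countable_Iio (α : Omega1) : (Iio α).Countable := by
  have h : (Ordinal.ToType.toOrd α : Ordinal.{0}) < Ordinal.omega 1 := (Ordinal.ToType.toOrd α).2
  have h2 : (Iio (Ordinal.ToType.toOrd α : Ordinal.{0})).Countable := by
    rw [← Cardinal.le_aleph0_iff_set_countable, Cardinal.mk_Iio_ordinal, Cardinal.lift_le_aleph0]
    generalize (Ordinal.ToType.toOrd α : Ordinal.{0}) = o at h
    rw [← Cardinal.ord_aleph, Cardinal.lt_ord, ← Cardinal.succ_aleph0, Order.lt_succ_iff] at h
    exact h
  refine (h2.preimage (f := fun x : Omega1 => ((Ordinal.ToType.toOrd x : Set.Iio _) : Ordinal.{0}))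
    fun x y hxy => ?_).mono fun x hx => ?_
  · exact Ordinal.ToType.mk.symm.injective (Subtype.ext hxy)
  · exact Subtype.coe_lt_coe.2 (Ordinal.ToType.mk.symm.lt_iff_lt.2 hx)

theorem countable_Iic (α : Omega1) : (Iic α).Countable :=
  (countable_Iio (Order.succ α)).mono (Iic_subset_Iio.2 (Order.lt_succ α))

theorem exists_upper {ι : Type*} [Countable ι] (f : ι → Omega1) : ∃ β, ∀ i, f i < β :=
  (exists_upper_of_countable (countable_range f)).imp fun _ h i => h _ (mem_range_self i)

/-- The ordinals closed under a given function are unbounded. -/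
theorem exists_closed_under (δ : Omega1 → Omega1) (γ : Omega1) :
    ∃ α, γ < α ∧ ∀ β < α, δ β < α := by
  have step : ∀ β : Omega1, ∃ β', β < β' ∧ ∀ η ≤ β, δ η < β' := fun β => by
    obtain ⟨b, hb⟩ := exists_upper_of_countable
      (((countable_Iic β).image δ).union (countable_singleton β))
    exact ⟨b, hb _ (Or.inr rfl), fun η hη => hb _ (Or.inl ⟨η, hη, rfl⟩)⟩
  choose g hg hg' using step
  let a : ℕ → Omega1 := fun n => g^[n] (Order.succ γ)
  have ha : ∀ n, a (n + 1) = g (a n) := fun n => Function.iterate_succ_apply' g n _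
  obtain ⟨b, hb⟩ := exists_upper a
  have hwf := wellFounded_lt (α := Omega1)
  -- The least strict upper bound of the orbit works: anything below it is at most some `a n`, and
  -- its image under `δ` is then below `a (n + 1)`.
  let S : Set Omega1 := {x | ∀ n, a n < x}
  have hS : S.Nonempty := ⟨b, hb⟩
  refine ⟨hwf.min S hS, (Order.lt_succ γ).trans (hwf.min_mem S hS 0), fun β hβ => ?_⟩
  have : β ∉ S := fun h => hwf.not_lt_min S h hβ
  obtain ⟨n, hn⟩ : ∃ n, β ≤ a n := by
    by_contra! hcon
    exact this hcon
  have h1 := hg' (a n) β hn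
  rw [← ha] at h1
  exact h1.trans (hwf.min_mem S hS _)

theorem exists_isSuccPrelimit (γ : Omega1) : ∃ α, γ < α ∧ Order.IsSuccPrelimit α := by
  obtain ⟨α, h, h'⟩ := exists_closed_under Order.succ γ
  exact ⟨α, h, Order.isSuccPrelimit_of_succ_lt h'⟩

theorem exists_eq_succ_of_not_isSuccPrelimit {α : Omega1} (h : ¬ Order.IsSuccPrelimit α) :
    ∃ β, α = Order.succ β := by
  obtain ⟨β, hβ⟩ := Order.not_isSuccPrelimit_iff.1 h
  exact ⟨β, hβ.succ_eq.symm⟩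

theorem exists_isLeast {S : Set Omega1} (hS : S.Nonempty) : ∃ α, IsLeast S α :=
  ⟨_, (wellFounded_lt (α := Omega1)).min_mem S hS, fun _ hx =>
    not_lt.1 ((wellFounded_lt (α := Omega1)).not_lt_min S hx)⟩

end Omega1

/-! ### The long ray -/

namespace LongRay

/-- The first coordinate of a point of the long ray. -/
def idx (x : LongRay) : Omega1 := (ofLex (x : Omega1 ×ₗ Set.Ico (0 : ℝ) 1)).1

/-- The second coordinate of a point of the long ray. -/
def frac (x : LongRay) : Set.Ico (0 : ℝ) 1 := (ofLex (x : Omega1 ×ₗ Set.Ico (0 : ℝ) 1)).2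

/-- The point of the long ray with given coordinates. -/
def mk (α : Omega1) (r : Set.Ico (0 : ℝ) 1) : LongRay :=
  (toLex (α, r) : Omega1 ×ₗ Set.Ico (0 : ℝ) 1)

@[simp] theorem idx_mk (α : Omega1) (r) : (mk α r).idx = α := rfl
@[simp] theorem frac_mk (α : Omega1) (r) : (mk α r).frac = r := rfl

theorem lt_iff {x y : LongRay} : x < y ↔ x.idx < y.idx ∨ x.idx = y.idx ∧ x.frac < y.frac :=
  Prod.Lex.lt_iff

theorem le_iff {x y : LongRay} : x ≤ y ↔ x.idx < y.idx ∨ x.idx = y.idx ∧ x.frac ≤ y.frac :=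
  Prod.Lex.le_iff

@[simp] theorem idx_ofOmega1 (α : Omega1) : (ofOmega1 α).idx = α := rfl

theorem zero_le_frac (x : LongRay) : (⟨0, by norm_num⟩ : Set.Ico (0 : ℝ) 1) ≤ x.frac :=
  Subtype.mk_le_mk.2 x.frac.2.1

theorem ofOmega1_le {α : Omega1} {x : LongRay} : ofOmega1 α ≤ x ↔ α ≤ x.idx := by
  rw [le_iff]
  refine ⟨fun h => h.elim le_of_lt fun h => h.1.le, fun h => ?_⟩
  rcases h.lt_or_eq with h | h
  · exact Or.inl h
  · exact Or.inr ⟨h, zero_le_frac x⟩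

theorem lt_ofOmega1 {α : Omega1} {x : LongRay} : x < ofOmega1 α ↔ x.idx < α := by
  rw [← not_le, ofOmega1_le, not_le]

theorem ofOmega1_strictMono : StrictMono ofOmega1 := fun _ _ h => lt_ofOmega1.2 h

@[simp] theorem ofOmega1_le_ofOmega1 {α β : Omega1} : ofOmega1 α ≤ ofOmega1 β ↔ α ≤ β :=
  ofOmega1_le

@[simp] theorem ofOmega1_lt_ofOmega1 {α β : Omega1} : ofOmega1 α < ofOmega1 β ↔ α < β :=
  lt_ofOmega1

theorem idx_mono : Monotone idx := fun _ _ h => (le_iff.1 h).elim le_of_lt fun h => h.1.le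

theorem lt_ofOmega1_succ (x : LongRay) : x < ofOmega1 (Order.succ x.idx) :=
  lt_ofOmega1.2 (Order.lt_succ _)

instance : NoMaxOrder LongRay := ⟨fun x => ⟨_, lt_ofOmega1_succ x⟩⟩

instance : Nonempty LongRay := ⟨ofOmega1 (Classical.arbitrary _)⟩

/-- Countable subsets of the long ray are bounded. -/
theorem exists_upper {ι : Type*} [Countable ι] (f : ι → LongRay) : ∃ b, ∀ i, f i < b := by
  obtain ⟨β, hβ⟩ := Omega1.exists_upper fun i => (f i).idx
  exact ⟨ofOmega1 β, fun i => lt_ofOmega1.2 (hβ i)⟩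

/-- Keeping the first coordinate of `x` and making the second one rational gives density and, on
initial segments, a countable dense set. -/
theorem exists_rat_between {x y : LongRay} (h : x < y) :
    ∃ r : Set.Ico (0 : ℝ) 1, (∃ q : ℚ, (q : ℝ) = r) ∧ x < mk x.idx r ∧ mk x.idx r < y := by
  by_cases hxy : x.idx = y.idx
  · have h2 : (x.frac : ℝ) < y.frac := by
      rcases lt_iff.1 h with h | h
      · exact absurd hxy h.ne
      · exact h.2
    obtain ⟨q, hr, hr'⟩ := exists_rat_btwn h2
    exact ⟨⟨q, x.frac.2.1.trans hr.le, hr'.trans y.frac.2.2⟩, ⟨q, rfl⟩,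
      lt_iff.2 (Or.inr ⟨rfl, hr⟩), lt_iff.2 (Or.inr ⟨hxy, hr'⟩)⟩
  · obtain ⟨q, hr, hr'⟩ := exists_rat_btwn x.frac.2.2
    exact ⟨⟨q, x.frac.2.1.trans hr.le, hr'⟩, ⟨q, rfl⟩, lt_iff.2 (Or.inr ⟨rfl, hr⟩),
      lt_iff.2 (Or.inl ((idx_mono h.le).lt_of_ne hxy))⟩

instance : DenselyOrdered LongRay :=
  ⟨fun _ _ h => let ⟨_, _, h1, h2⟩ := exists_rat_between h; ⟨_, h1, h2⟩⟩

theorem exists_isLUB {S : Set LongRay} (hb : BddAbove S) :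
    ∃ b, IsLUB S b := by
  obtain ⟨b, hb⟩ := hb
  obtain ⟨α, hα, hmin⟩ := Omega1.exists_isLeast (S := {α | ∀ x ∈ S, x.idx ≤ α})
    ⟨b.idx, fun x hx => idx_mono (hb hx)⟩
  -- The extra 0 covers the case where no point of `S` has first coordinate `α`. If the supremum of
  -- `R` is 1, the least upper bound is `α + 1`.
  let R : Set ℝ := insert 0 ((fun x : LongRay => (x.frac : ℝ)) '' {x ∈ S | x.idx = α})
  have hRne : R.Nonempty := ⟨0, mem_insert _ _⟩
  have hR1 : ∀ r ∈ R, r ≤ 1 := by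
    rintro r (rfl | ⟨x, -, rfl⟩)
    · exact zero_le_one
    · exact x.frac.2.2.le
  have hRb : BddAbove R := ⟨1, hR1⟩
  have h0 : 0 ≤ sSup R := le_csSup hRb (mem_insert _ _)
  have hmem : ∀ x ∈ S, x.idx = α → (x.frac : ℝ) ≤ sSup R := fun x hx hxα =>
    le_csSup hRb (mem_insert_of_mem _ ⟨x, ⟨hx, hxα⟩, rfl⟩)
  have hub : ∀ y ∈ upperBounds S, α < y.idx ∨ y.idx = α ∧ sSup R ≤ y.frac := by
    intro y hy
    have h1 : α ≤ y.idx := hmin fun x hx => idx_mono (hy hx)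
    rcases h1.lt_or_eq with h1 | h1
    · exact Or.inl h1
    · refine Or.inr ⟨h1.symm, csSup_le hRne ?_⟩
      rintro r (rfl | ⟨x, ⟨hx, hxα⟩, rfl⟩)
      · exact y.frac.2.1
      · rcases le_iff.1 (hy hx) with h | h
        · exact absurd (hxα.trans h1) h.ne
        · exact h.2
  by_cases h1 : sSup R < 1
  · refine ⟨mk α ⟨sSup R, h0, h1⟩, fun x hx => le_iff.2 ?_, fun y hy => le_iff.2 ?_⟩
    · exact (hα x hx).lt_or_eq.imp id fun h => ⟨h, hmem x hx h⟩
    · exact (hub y hy).imp id fun h => ⟨h.1.symm, h.2⟩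
  · refine ⟨ofOmega1 (Order.succ α), fun x hx => ?_, fun y hy => ?_⟩
    · exact (lt_ofOmega1.2 (Order.lt_succ_of_le (hα x hx))).le
    · rcases hub y hy with h | h
      · exact ofOmega1_le.2 (Order.succ_le_of_lt h)
      · exact absurd (h.2.trans_lt y.frac.2.2) h1

-- The default value for empty or unbounded sets is the least point, so that suprema of unbounded
-- sets agree with that of the empty set.
open Classical in
noncomputable instance : SupSet LongRay :=
  ⟨fun S => if h : S.Nonempty ∧ BddAbove S then (exists_isLUB h.2).choose
    else ofOmega1 (Omega1.exists_isLeast univ_nonempty).choose⟩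

theorem bot_le (x : LongRay) :
    ofOmega1 (Omega1.exists_isLeast (univ_nonempty (α := Omega1))).choose ≤ x :=
  ofOmega1_le.2 ((Omega1.exists_isLeast univ_nonempty).choose_spec.2 trivial)

noncomputable instance : ConditionallyCompleteLinearOrder LongRay where
  __ := (inferInstance : LinearOrder LongRay)
  __ := conditionallyCompleteLatticeOfLatticeOfsSup LongRay fun S hb hne => by
    simpa [sSup, hb, hne] using (exists_isLUB hb).choose_spec
  csSup_of_not_bddAbove := fun S hS => by
    change sSup S = sSup ∅
    simp [sSup, hS]
  csInf_of_not_bddBelow := fun S hS => absurd ⟨_, fun x _ => bot_le x⟩ hS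

theorem isCompact_Iic (x : LongRay) : IsCompact (Iic x) := by
  convert isCompact_Icc (a := ofOmega1 (Omega1.exists_isLeast univ_nonempty).choose) (b := x)
  ext y
  simp [bot_le y]

theorem countable_subset_Iio {A : Set LongRay} (hA : A.Countable) : ∃ α, A ⊆ Iio (ofOmega1 α) := by
  obtain ⟨β, hβ⟩ := exists_upper_of_countable (hA.image idx)
  exact ⟨β, fun x hx => lt_ofOmega1.2 (hβ _ ⟨x, hx, rfl⟩)⟩

theorem isOmegaBounded : IsOmegaBounded LongRay := fun A hA => by
  obtain ⟨α, hα⟩ := countable_subset_Iio hA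
  exact (isCompact_Iic (ofOmega1 α)).of_isClosed_subset isClosed_closure
    (closure_minimal (hα.trans Iio_subset_Iic_self) isClosed_Iic)

/-- Two closed unbounded subsets of the long ray meet. -/
theorem inter_nonempty {F G : Set LongRay} (hF : IsClosed F) (hG : IsClosed G)
    (hF' : ¬ BddAbove F) (hG' : ¬ BddAbove G) : (F ∩ G).Nonempty := by
  rw [not_bddAbove_iff] at hF' hG'
  choose f hf hf' using hF'
  choose g hg hg' using hG'
  -- The points `a n < f (a n) < a (n + 1)` lie alternately in `F` and `G` (apart from `a 0`), so
  -- both sequences converge to the same supremum, which lies in both sets.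
  let a : ℕ → LongRay := fun n => (g ∘ f)^[n] (Classical.arbitrary _)
  have ha : ∀ n, a (n + 1) = g (f (a n)) := fun n => Function.iterate_succ_apply' _ n _
  have h1 : ∀ n, a n < f (a n) := fun n => hf' _
  have h2 : ∀ n, f (a n) < a (n + 1) := fun n => by rw [ha]; exact hg' _
  obtain ⟨b, hb⟩ := exists_upper a
  have hbdd : BddAbove (range a) := ⟨b, by rintro _ ⟨n, rfl⟩; exact (hb n).le⟩
  have hlub := isLUB_csSup (range_nonempty a) hbdd
  have hmono : StrictMono a := strictMono_nat_of_lt_succ fun n => (h1 n).trans (h2 n)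
  have hta : Filter.Tendsto a Filter.atTop (𝓝 (sSup (range a))) :=
    tendsto_atTop_isLUB hmono.monotone hlub
  have hta' := hta.comp (Filter.tendsto_add_atTop_nat 1)
  have htf : Filter.Tendsto (fun n => f (a n)) Filter.atTop (𝓝 (sSup (range a))) :=
    tendsto_of_tendsto_of_tendsto_of_le_of_le hta hta' (fun n => (h1 n).le) fun n => (h2 n).le
  exact ⟨_, hF.mem_of_tendsto htf (Filter.Eventually.of_forall fun n => hf _),
    hG.mem_of_tendsto hta' (Filter.Eventually.of_forall fun n => by
      rw [Function.comp_apply, ha]; exact hg _)⟩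

/-- An unbounded continuous self-map of the long ray is proper. -/
theorem bddAbove_preimage_Iic {f : LongRay → LongRay} (hf : Continuous f)
    (hub : ¬ BddAbove (range f)) (c : LongRay) : BddAbove (f ⁻¹' Iic c) := by
  by_contra hc
  obtain ⟨d, hd⟩ := exists_gt c
  -- Otherwise `f` would be bounded beyond some `b` by `d`, and on the compact set `Iic b` by
  -- continuity. The two closed unbounded sets `f ⁻¹' Iic c` and `f ⁻¹' Ici d` then meet, although
  -- `c < d`.
  have : ¬ BddAbove (f ⁻¹' Ici d) := by
    rintro ⟨b, hb⟩
    obtain ⟨m, hm⟩ := ((isCompact_Iic b).image hf).bddAbove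
    refine hub ⟨max d m, ?_⟩
    rintro _ ⟨x, rfl⟩
    rcases le_total d (f x) with h | h
    · exact (hm ⟨x, hb h, rfl⟩).trans (le_max_right _ _)
    · exact h.trans (le_max_left _ _)
  obtain ⟨x, h1, h2⟩ := inter_nonempty (isClosed_Iic.preimage hf) (isClosed_Ici.preimage hf) hc this
  exact (lt_of_lt_of_le hd (h2.trans h1)).false

instance (x : LongRay) : SecondCountableTopology (Iio x) := by
  have : TopologicalSpace.SeparableSpace (Iio x) := by
    let Q : Set (Set.Ico (0 : ℝ) 1) := {r | ∃ q : ℚ, (q : ℝ) = r}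
    have hQ : Q.Countable := by
      refine ((countable_range (fun q : ℚ => (q : ℝ))).preimage (Subtype.val_injective)).mono ?_
      rintro r ⟨q, hq⟩
      exact ⟨q, hq⟩
    have hD : (image2 mk (Iic x.idx) Q).Countable := (Omega1.countable_Iic _).image2 hQ _
    refine ⟨_, hD.preimage Subtype.val_injective, ?_⟩
    refine dense_iff_inter_open.2 fun G hG ⟨z, hz⟩ => ?_
    obtain ⟨y, hzy, hzG⟩ := exists_Ico_subset_of_mem_nhds (hG.mem_nhds hz) (exists_gt z)
    obtain ⟨r, hr, h1, h2⟩ := exists_rat_between (x := z) (y := y) hzy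
    exact ⟨⟨mk z.1.idx r, h2.trans y.2⟩, hzG ⟨h1.le, h2⟩,
      ⟨_, idx_mono z.2.le, r, hr, rfl⟩⟩
  exact .of_separableSpace_orderTopology _

end LongRay

/-! ### Type I spaces -/

/-- Finitely many members of a cover suffice for a tube around each fibre `{x} × T`, and countably
many tubes cover the product. -/
theorem IsLindelof.prod_isCompact {X Y : Type*} [TopologicalSpace X] [TopologicalSpace Y]
    {K : Set X} {T : Set Y} (hK : IsLindelof K) (hT : IsCompact T) : IsLindelof (K ×ˢ T) := by
  refine isLindelof_of_countable_subcover fun {ι} V hV hcov => ?_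
  have h1 : ∀ x ∈ K, ∃ F : Finset ι, ∃ u : Set X, IsOpen u ∧ x ∈ u ∧
      u ×ˢ T ⊆ ⋃ i ∈ F, V i := by
    intro x hx
    obtain ⟨F, hF⟩ := (isCompact_singleton.prod hT).elim_finite_subcover V hV
      ((prod_mono (singleton_subset_iff.2 hx) subset_rfl).trans hcov)
    obtain ⟨u, v, hu, -, hxu, hTv, huv⟩ := generalized_tube_lemma isCompact_singleton hT
      (isOpen_biUnion fun i (_ : i ∈ F) => hV i) hF
    exact ⟨F, u, hu, hxu rfl, (prod_mono subset_rfl hTv).trans huv⟩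
  choose! F u hu hxu hF using h1
  obtain ⟨t, ht, htK, hcov'⟩ := hK.elim_nhds_subcover u fun x hx => (hu x hx).mem_nhds (hxu x hx)
  refine ⟨⋃ x ∈ t, (F x : Set ι), ht.biUnion fun x _ => (F x).countable_toSet, ?_⟩
  rintro ⟨x, y⟩ ⟨hx, hy⟩
  obtain ⟨z, hz, hxz⟩ := mem_iUnion₂.1 (hcov' hx)
  obtain ⟨i, hi, hxi⟩ := mem_iUnion₂.1 (hF z (htK z hz) (mk_mem_prod hxz hy))
  exact mem_iUnion₂.2 ⟨i, mem_iUnion₂.2 ⟨z, hz, hi⟩, hxi⟩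

section TypeI

variable {X Y : Type*} [TopologicalSpace X] [TopologicalSpace Y] {U : Omega1 → Set X}

theorem IsTypeISeq.mono (hU : IsTypeISeq U) : Monotone U := fun α β h => by
  rcases h.lt_or_eq with h | rfl
  · exact subset_closure.trans (hU.closure_subset α β h)
  · exact subset_rfl

theorem IsTypeISeq.exists_mem (hU : IsTypeISeq U) (x : X) : ∃ α, x ∈ U α :=
  mem_iUnion.1 (hU.iUnion_eq ▸ mem_univ x)

theorem IsTypeISeq.exists_superset (hU : IsTypeISeq U) {K : Set X} (hK : IsLindelof K) :
    ∃ α, K ⊆ U α := by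
  obtain ⟨t, ht, hsub⟩ := hK.elim_countable_subcover U hU.isOpen (by simp [hU.iUnion_eq])
  obtain ⟨β, hβ⟩ := exists_upper_of_countable ht
  refine ⟨β, hsub.trans (iUnion₂_subset fun γ hγ => hU.mono (hβ γ hγ).le)⟩

theorem IsTypeISeq.exists_superset_of_countable (hU : IsTypeISeq U) {A : Set X}
    (hA : A.Countable) : ∃ α, A ⊆ U α :=
  hU.exists_superset hA.isLindelof

/-- The continuous image of a bounded set is bounded. -/
theorem IsBoundedSet.exists_image_subset (hU : IsTypeISeq U) {A : Set Y} (hA : IsBoundedSet A)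
    {g : Y → X} (hg : Continuous g) : ∃ α, g '' A ⊆ U α := by
  obtain ⟨V, hV, β, hβ⟩ := hA
  obtain ⟨α, hα⟩ := hU.exists_superset ((hV.isLindelof_closure β).image hg)
  exact ⟨α, (image_mono (hβ.trans subset_closure)).trans hα⟩

theorem IsTypeISeq.not_lindelofSpace (hU : IsTypeISeq U) (h : ∀ α, ∃ x, x ∉ U α) :
    ¬ LindelofSpace X := fun hX => by
  obtain ⟨α, hα⟩ := hU.exists_superset hX.isLindelof_univ
  obtain ⟨x, hx⟩ := h α
  exact hx (hα trivial)

theorem IsTypeI.exists_notMem (hX : IsTypeI X) (hU : IsTypeISeq U) (α : Omega1) :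
    ∃ x, x ∉ U α := by
  by_contra! h
  refine hX.not_lindelof ⟨(hU.isLindelof_closure α).of_isClosed_subset isClosed_univ ?_⟩
  exact fun x _ => subset_closure (h x)

/-- Each point lies in a unique slice of a canonical sequence. -/
theorem IsCanonicalSeq.exists_mem_diff (hU : IsCanonicalSeq U) (x : X) :
    ∃ β, x ∈ U (Order.succ β) \ U β := by
  obtain ⟨δ, hδ, hmin⟩ := Omega1.exists_isLeast (S := {δ | x ∈ U δ}) (hU.isTypeISeq.exists_mem x)
  obtain ⟨β, rfl⟩ : ∃ β, δ = Order.succ β := by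
    refine Omega1.exists_eq_succ_of_not_isSuccPrelimit fun hlim => ?_
    have hδ' : x ∈ U δ := hδ
    rw [hU.eq_iUnion δ hlim] at hδ'
    obtain ⟨β, hβ, hx⟩ := mem_iUnion₂.1 hδ'
    exact (hmin hx).not_gt hβ
  exact ⟨β, hδ, fun h => (hmin h).not_gt (Order.lt_succ β)⟩

theorem IsSlicer.le_of_notMem {s : X → LongRay} (hs : IsSlicer U s) (hU : IsCanonicalSeq U)
    {α : Omega1} {x : X} (hx : x ∉ U α) : LongRay.ofOmega1 α ≤ s x := by
  obtain ⟨β, hβ, hβ'⟩ := hU.exists_mem_diff x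
  have h1 : α ≤ β := by
    by_contra! h
    exact hx (hU.isTypeISeq.mono (Order.succ_le_of_lt h) hβ)
  exact (LongRay.ofOmega1_le_ofOmega1.2 h1).trans
    (hs.mem_Icc β x ⟨subset_closure hβ, hβ'⟩).1

theorem IsSlicer.le_of_mem {s : X → LongRay} (hs : IsSlicer U s) (hU : IsCanonicalSeq U)
    {α : Omega1} {x : X} (hx : x ∈ U α) : s x ≤ LongRay.ofOmega1 α := by
  obtain ⟨β, hβ, hβ'⟩ := hU.exists_mem_diff x
  have h1 : β < α := by
    by_contra! h
    exact hβ' (hU.isTypeISeq.mono h hx)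
  exact (hs.mem_Icc β x ⟨subset_closure hβ, hβ'⟩).2.trans
    (LongRay.ofOmega1_le_ofOmega1.2 (Order.succ_le_of_lt h1))

theorem IsSlicer.le_of_mem_closure {s : X → LongRay} (hs : IsSlicer U s)
    (hU : IsCanonicalSeq U) {α : Omega1} {x : X} (hx : x ∈ closure (U α)) :
    s x ≤ LongRay.ofOmega1 α :=
  closure_minimal (fun _ h => hs.le_of_mem hU h) (isClosed_Iic.preimage hs.continuous) hx

end TypeI

/-! ### The topology of `Σ(X, s)` -/

namespace SigmaSpace

variable {X : Type*} {s : X → LongRay}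

theorem body_injective : Function.Injective (body : _ → SigmaSpace s) := Sum.inl_injective

theorem core_injective : Function.Injective (core : _ → SigmaSpace s) := Sum.inr_injective

theorem body_ne_core (p : X × Set.Ico (0 : ℝ) 1) (x : LongRay) :
    (body p : SigmaSpace s) ≠ core x := Sum.inl_ne_inr

theorem body_or_core (z : SigmaSpace s) : (∃ p, z = body p) ∨ ∃ x, z = core x := by
  rcases z with p | x
  · exact Or.inl ⟨p, rfl⟩
  · exact Or.inr ⟨x, rfl⟩

/-- The set with given traces on the body and on the core. -/
def glue (s : X → LongRay) (A : Set (X × Set.Ico (0 : ℝ) 1)) (V : Set LongRay) :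
    Set (SigmaSpace s) := body '' A ∪ core '' V

@[simp] theorem body_mem_glue {A : Set (X × Set.Ico (0 : ℝ) 1)} {V : Set LongRay} {p} :
    (body p : SigmaSpace s) ∈ glue s A V ↔ p ∈ A := by
  refine ⟨?_, fun h => Or.inl ⟨p, h, rfl⟩⟩
  rintro (⟨q, hq, h⟩ | ⟨x, -, h⟩)
  · exact body_injective h ▸ hq
  · exact absurd h.symm (body_ne_core p x)

@[simp] theorem core_mem_glue {A : Set (X × Set.Ico (0 : ℝ) 1)} {V : Set LongRay} {x} :
    (core x : SigmaSpace s) ∈ glue s A V ↔ x ∈ V := by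
  refine ⟨?_, fun h => Or.inr ⟨x, h, rfl⟩⟩
  rintro (⟨q, -, h⟩ | ⟨y, hy, h⟩)
  · exact absurd h (body_ne_core q x)
  · exact core_injective h ▸ hy

theorem coreNhd_eq (V : Set LongRay) (a : ℝ) :
    coreNhd s V a = glue s {p | s p.1 ∈ V ∧ a < (p.2 : ℝ)} V := union_comm _ _

open Classical in
/-- The natural map from the closed cylinder over `X`. -/
noncomputable def cyl (s : X → LongRay) (p : X × unitInterval) : SigmaSpace s :=
  if h : (p.2 : ℝ) < 1 then body (p.1, ⟨p.2, p.2.2.1, h⟩) else core (s p.1)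

theorem cyl_of_lt {p : X × unitInterval} (h : (p.2 : ℝ) < 1) :
    cyl s p = body (p.1, ⟨p.2, p.2.2.1, h⟩) := dif_pos h

theorem cyl_of_not_lt {p : X × unitInterval} (h : ¬ (p.2 : ℝ) < 1) : cyl s p = core (s p.1) :=
  dif_neg h

@[simp] theorem cyl_one (x : X) : cyl s (x, 1) = core (s x) := dif_neg (by simp)

theorem body_eq_cyl (p : X × Set.Ico (0 : ℝ) 1) :
    (body p : SigmaSpace s) = cyl s (p.1, ⟨p.2, p.2.2.1, p.2.2.2.le⟩) :=
  (cyl_of_lt (s := s) (p := (p.1, ⟨p.2, p.2.2.1, p.2.2.2.le⟩)) p.2.2.2).symm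

variable [TopologicalSpace X]

theorem isOpen_iff {G : Set (SigmaSpace s)} :
    IsOpen G ↔ IsOpen (body ⁻¹' G : Set (X × Set.Ico (0 : ℝ) 1)) ∧
    ∀ x : LongRay, core x ∈ G →
      ∃ V : Set LongRay, IsOpen V ∧ x ∈ V ∧ ∃ a : ℝ, 0 ≤ a ∧ a < 1 ∧ coreNhd s V a ⊆ G := Iff.rfl

theorem isOpen_glue {A : Set (X × Set.Ico (0 : ℝ) 1)} {V : Set LongRay} (hA : IsOpen A)
    (h : ∀ x ∈ V, ∃ W : Set LongRay, IsOpen W ∧ x ∈ W ∧ W ⊆ V ∧ ∃ a : ℝ, 0 ≤ a ∧ a < 1 ∧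
      ∀ p : X × Set.Ico (0 : ℝ) 1, s p.1 ∈ W → a < p.2 → p ∈ A) : IsOpen (glue s A V) := by
  refine isOpen_iff.2 ⟨?_, fun x hx => ?_⟩
  · convert hA using 1
    ext p
    simp
  · obtain ⟨W, hW, hxW, hWV, a, ha0, ha1, hWa⟩ := h x (core_mem_glue.1 hx)
    refine ⟨W, hW, hxW, a, ha0, ha1, ?_⟩
    rintro _ (⟨y, hy, rfl⟩ | ⟨p, ⟨hp, hap⟩, rfl⟩)
    · exact core_mem_glue.2 (hWV hy)
    · exact body_mem_glue.2 (hWa p hp hap)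

theorem isClosed_glue {A : Set (X × Set.Ico (0 : ℝ) 1)} {V : Set LongRay} (hA : IsClosed A)
    (h : ∀ x ∉ V, ∃ W : Set LongRay, IsOpen W ∧ x ∈ W ∧ Disjoint W V ∧ ∃ a : ℝ, 0 ≤ a ∧ a < 1 ∧
      ∀ p : X × Set.Ico (0 : ℝ) 1, s p.1 ∈ W → a < p.2 → p ∉ A) : IsClosed (glue s A V) := by
  rw [← isOpen_compl_iff]
  have : (glue s A V)ᶜ = glue s Aᶜ Vᶜ := by
    ext z
    rcases body_or_core z with ⟨p, rfl⟩ | ⟨x, rfl⟩ <;> simp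
  rw [this]
  refine isOpen_glue hA.isOpen_compl fun x hx => ?_
  obtain ⟨W, hW, hxW, hWV, a, ha0, ha1, hWa⟩ := h x hx
  exact ⟨W, hW, hxW, hWV.subset_compl_right, a, ha0, ha1, hWa⟩

theorem isOpen_coreNhd (hs : Continuous s) {V : Set LongRay} (hV : IsOpen V) {a : ℝ} (ha0 : 0 ≤ a)
    (ha1 : a < 1) : IsOpen (coreNhd s V a) := by
  rw [coreNhd_eq]
  refine isOpen_glue ?_ fun x hx => ⟨V, hV, hx, subset_rfl, a, ha0, ha1, fun p h h' => ⟨h, h'⟩⟩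
  exact (hV.preimage (hs.comp continuous_fst)).inter
    (isOpen_lt continuous_const (continuous_subtype_val.comp continuous_snd))

theorem continuous_body : Continuous (body : X × Set.Ico (0 : ℝ) 1 → SigmaSpace s) :=
  ⟨fun _ hG => (isOpen_iff.1 hG).1⟩

theorem continuous_core : Continuous (core : LongRay → SigmaSpace s) := by
  refine ⟨fun G hG => isOpen_iff_forall_mem_open.2 fun x hx => ?_⟩
  obtain ⟨V, hV, hxV, a, -, -, hVG⟩ := (isOpen_iff.1 hG).2 x hx
  exact ⟨V, fun y hy => hVG (Or.inl ⟨y, hy, rfl⟩), hV, hxV⟩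

theorem isOpenMap_body : IsOpenMap (body : X × Set.Ico (0 : ℝ) 1 → SigmaSpace s) := by
  intro A hA
  have : (body '' A : Set (SigmaSpace s)) = glue s A ∅ := by simp [glue]
  rw [this]
  exact isOpen_glue hA fun x hx => absurd hx (notMem_empty x)

theorem isOpenEmbedding_body :
    IsOpenEmbedding (body : X × Set.Ico (0 : ℝ) 1 → SigmaSpace s) :=
  .of_continuous_injective_isOpenMap continuous_body body_injective isOpenMap_body

theorem continuous_cyl (hs : Continuous s) : Continuous (cyl s) := by
  refine continuous_iff_continuousAt.2 fun p => ?_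
  by_cases h : (p.2 : ℝ) < 1
  · let A : Set (X × unitInterval) := {p | (p.2 : ℝ) < 1}
    have hA : IsOpen A :=
      isOpen_lt (continuous_subtype_val.comp continuous_snd) continuous_const
    refine ContinuousOn.continuousAt (s := A) ?_ (hA.mem_nhds h)
    rw [continuousOn_iff_continuous_domRestrict]
    have : A.domRestrict (cyl s) = fun q : A => body (q.1.1, ⟨q.1.2, q.1.2.2.1, q.2⟩) :=
      funext fun q => cyl_of_lt q.2
    rw [this]
    exact continuous_body.comp (by fun_prop)
  · have h1 : (p.2 : ℝ) = 1 := le_antisymm p.2.2.2 (not_lt.1 h)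
    intro G hG
    obtain ⟨G', hG'G, hG', hpG⟩ := mem_nhds_iff.1 hG
    rw [cyl, dif_neg h] at hpG
    obtain ⟨V, hV, hxV, a, -, ha1, hVG⟩ := (isOpen_iff.1 hG').2 _ hpG
    have hop : IsOpen {q : X × unitInterval | s q.1 ∈ V ∧ a < (q.2 : ℝ)} :=
      (hV.preimage (hs.comp continuous_fst)).inter
        (isOpen_lt continuous_const (continuous_subtype_val.comp continuous_snd))
    refine Filter.mem_map.2 (Filter.mem_of_superset (hop.mem_nhds ⟨hxV, h1 ▸ ha1⟩) ?_)
    rintro q ⟨hq, hq'⟩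
    refine hG'G (hVG ?_)
    by_cases h2 : (q.2 : ℝ) < 1
    · exact Or.inr ⟨_, ⟨hq, hq'⟩, (cyl_of_lt h2).symm⟩
    · exact Or.inl ⟨_, hq, (cyl_of_not_lt h2).symm⟩

/-- The neighborhood `W(V, b)` with `V` the whole ray misses such a set, so no core point is in its
closure. -/
theorem isClosed_body_le {A : Set (X × Set.Ico (0 : ℝ) 1)} (hA : IsClosed A) {b : ℝ} (hb0 : 0 ≤ b)
    (hb : b < 1) (hAb : ∀ p ∈ A, (p.2 : ℝ) ≤ b) : IsClosed (glue s A ∅) :=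
  isClosed_glue hA fun _ _ => ⟨univ, isOpen_univ, trivial, disjoint_bot_right, b, hb0, hb,
    fun p _ hp hpA => (hAb p hpA).not_gt hp⟩

protected theorem t3Space [T3Space X] (hs : Continuous s) : T3Space (SigmaSpace s) := by
  have hreg : RegularSpace (SigmaSpace s) := by
    refine .of_exists_mem_nhds_isClosed_subset fun z G hG => ?_
    obtain ⟨G', hG'G, hG', hzG⟩ := mem_nhds_iff.1 hG
    rcases body_or_core z with ⟨p, rfl⟩ | ⟨x, rfl⟩
    -- Cutting at height `b < 1` keeps the closed neighborhood away from the core.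
    · obtain ⟨b, hpb, hb⟩ := exists_between p.2.2.2
      have h1 : (body ⁻¹' G' ∩ {q : X × Set.Ico (0 : ℝ) 1 | (q.2 : ℝ) < b}) ∈ 𝓝 p :=
        ((hG'.preimage continuous_body).inter (isOpen_lt (by fun_prop) continuous_const)).mem_nhds
          ⟨hzG, hpb⟩
      obtain ⟨K, hK, hKc, hKs⟩ := exists_mem_nhds_isClosed_subset h1
      refine ⟨glue s K ∅, ?_, isClosed_body_le hKc (p.2.2.1.trans hpb.le) hb
        fun q hq => (hKs hq).2.le, ?_⟩
      · exact Filter.mem_of_superset (isOpenMap_body.image_mem_nhds hK) subset_union_left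
      · rintro _ (⟨q, hq, rfl⟩ | ⟨y, hy, -⟩)
        · exact hG'G (hKs hq).1
        · exact absurd hy (notMem_empty y)
    · obtain ⟨V, hV, hxV, a, ha0, ha1, hVG⟩ := (isOpen_iff.1 hG').2 x hzG
      obtain ⟨b, hab, hb⟩ := exists_between ha1
      obtain ⟨K, hK, hKc, hKV⟩ := exists_mem_nhds_isClosed_subset (hV.mem_nhds hxV)
      obtain ⟨W, hWK, hW, hxW⟩ := mem_nhds_iff.1 hK
      refine ⟨glue s {p | s p.1 ∈ K ∧ b ≤ (p.2 : ℝ)} K, ?_, ?_, ?_⟩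
      · refine Filter.mem_of_superset ((isOpen_coreNhd hs hW (ha0.trans hab.le) hb).mem_nhds
          (Or.inl ⟨x, hxW, rfl⟩)) ?_
        rintro _ (⟨y, hy, rfl⟩ | ⟨p, ⟨hp, hap⟩, rfl⟩)
        · exact core_mem_glue.2 (hWK hy)
        · exact body_mem_glue.2 ⟨hWK hp, hap.le⟩
      · refine isClosed_glue ?_ fun y hy => ⟨Kᶜ, hKc.isOpen_compl, hy, disjoint_compl_left, 0,
          le_rfl, one_pos, fun p hp _ h => hp h.1⟩
        exact (hKc.preimage (hs.comp continuous_fst)).inter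
          (isClosed_le continuous_const (continuous_subtype_val.comp continuous_snd))
      · rintro _ (⟨q, hq, rfl⟩ | ⟨y, hy, rfl⟩)
        · exact hG'G (hVG (Or.inr ⟨q, ⟨hKV hq.1, hab.trans_le hq.2⟩, rfl⟩))
        · exact hG'G (hVG (Or.inl ⟨y, hKV hy, rfl⟩))
  have ht1 : T1Space (SigmaSpace s) := by
    refine ⟨fun z => ?_⟩
    rcases body_or_core z with ⟨p, rfl⟩ | ⟨x, rfl⟩
    · have : ({body p} : Set (SigmaSpace s)) = glue s {p} ∅ := by simp [glue]
      rw [this]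
      exact isClosed_body_le isClosed_singleton p.2.2.1 p.2.2.2 (by rintro q rfl; exact le_rfl)
    · have : ({core x} : Set (SigmaSpace s)) = glue s ∅ {x} := by simp [glue]
      rw [this]
      exact isClosed_glue isClosed_empty fun y hy => ⟨{x}ᶜ, isOpen_compl_singleton, hy,
        disjoint_compl_left, 0, le_rfl, one_pos, fun p _ _ h => h⟩
  exact { }

end SigmaSpace

/-! ### `ω`-bounded spaces -/

theorem IsOmegaBounded.countablyCompactSpace {X : Type*} [TopologicalSpace X]
    (hX : IsOmegaBounded X) : CountablyCompactSpace X := by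
  refine ⟨isCountablyCompact_iff_seq_clusterPt.2 fun x _ => ?_⟩
  obtain ⟨a, -, ha⟩ := isCountablyCompact_iff_seq_clusterPt.1
    (hX _ (countable_range x)).isCountablyCompact x
    (Filter.Eventually.of_forall fun n => subset_closure (mem_range_self n))
  exact ⟨a, trivial, ha⟩

theorem IsOmegaBounded.isCompact_of_isLindelof {X : Type*} [TopologicalSpace X]
    (hX : IsOmegaBounded X) {K : Set X} (hK : IsLindelof K) (hKc : IsClosed K) : IsCompact K := by
  have := hX.countablyCompactSpace
  exact hK.isCompact hKc.isCountablyCompact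

/-- A decreasing sequence of nonempty closed sets in a countably compact space has a common
point. -/
theorem exists_forall_mem_of_antitone {X : Type*} [TopologicalSpace X] [CountablyCompactSpace X]
    {G : ℕ → Set X} (hG : ∀ n, IsClosed (G n)) (hne : ∀ n, (G n).Nonempty) (hanti : Antitone G) :
    ∃ x, ∀ n, x ∈ G n := by
  choose x hx using hne
  obtain ⟨a, -, ha⟩ := isCountablyCompact_iff_seq_clusterPt.1
    (CountablyCompactSpace.isCountablyCompact_univ (E := X)) x (by simp)
  refine ⟨a, fun n => (hG n).closure_eq ▸ mem_closure_iff_clusterPt.2 (ClusterPt.mono ha ?_)⟩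
  refine Filter.le_principal_iff.2 (Filter.mem_map.2 ?_)
  filter_upwards [Filter.eventually_ge_atTop n] with m hm using hanti hm (hx m)

theorem exists_isOpen_inter_subset_singleton {X : Type*} [TopologicalSpace X] {D : Set X}
    (hD : DiscreteTopology D) {a : X} (ha : a ∈ D) :
    ∃ G, IsOpen G ∧ a ∈ G ∧ G ∩ D ⊆ {a} := by
  obtain ⟨G, hG, h⟩ := isOpen_induced_iff.1 (isOpen_discrete ({⟨a, ha⟩} : Set D))
  have haG : (⟨a, ha⟩ : D) ∈ Subtype.val ⁻¹' G := by rw [h]; rfl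
  refine ⟨G, hG, haG, fun y ⟨hyG, hyD⟩ => ?_⟩
  have : (⟨y, hyD⟩ : D) ∈ Subtype.val ⁻¹' G := hyG
  rw [h] at this
  exact congrArg Subtype.val this

theorem IsOmegaBounded.isOmega1Compact {X : Type*} [TopologicalSpace X]
    (hX : IsOmegaBounded X) : IsOmega1Compact X := fun D hD hdisc => by
  have := hX.countablyCompactSpace
  by_contra hunc
  have hinf : D.Infinite := fun h => hunc h.countable
  obtain ⟨a, haD, ha⟩ := hD.isCountablyCompact.exists_accPt_of_infinite subset_rfl hinf
  obtain ⟨G, hG, haG, hGD⟩ := exists_isOpen_inter_subset_singleton hdisc haD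
  obtain ⟨y, hy, hya⟩ := accPt_iff_nhds.1 ha G (hG.mem_nhds haG)
  exact hya (hGD hy)

/-! ### The Type I structure of `Σ(X, s)` -/

namespace SigmaSpace

variable {X : Type*} {s : X → LongRay} {U : Omega1 → Set X}

/-- The Type I sequence on `Σ(X, s)` obtained from one on `X`. -/
def seq (s : X → LongRay) (U : Omega1 → Set X) (α : Omega1) : Set (SigmaSpace s) :=
  glue s (U α ×ˢ univ) (Iio (LongRay.ofOmega1 α))

theorem glue_subset_cyl (A : Set X) (V : Set LongRay) :
    glue s (A ×ˢ univ) V ⊆ cyl s '' (A ×ˢ univ) ∪ core '' V := by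
  rintro _ (⟨p, hp, rfl⟩ | ⟨y, hy, rfl⟩)
  · exact Or.inl ⟨_, ⟨hp.1, trivial⟩, (body_eq_cyl p).symm⟩
  · exact Or.inr ⟨y, hy, rfl⟩

theorem core_notMem_seq (α : Omega1) : core (LongRay.ofOmega1 α) ∉ seq s U α := fun h =>
  lt_irrefl _ (mem_Iio.1 (core_mem_glue.1 h))

variable [TopologicalSpace X]

/-- The slicer satisfies `s ≤ α` on the closure of `U α`, so the sets `W(V, 0)` with `V` above `α`
avoid everything over it. -/
theorem closure_seq_subset (hU : IsCanonicalSeq U) (hs : IsSlicer U s) (α : Omega1) :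
    closure (seq s U α) ⊆ glue s (closure (U α) ×ˢ univ) (Iic (LongRay.ofOmega1 α)) := by
  refine closure_minimal ?_ (isClosed_glue (isClosed_closure.prod isClosed_univ) fun x hx => ?_)
  · exact union_subset_union (image_mono (prod_mono subset_closure subset_rfl))
      (image_mono Iio_subset_Iic_self)
  · refine ⟨Ioi (LongRay.ofOmega1 α), isOpen_Ioi,
      mem_Ioi.2 (not_le.1 fun h => hx (mem_Iic.2 h)),
      (disjoint_left.2 fun y hy hy' => not_lt.2 (mem_Iic.1 hy') (mem_Ioi.1 hy)), 0, le_rfl, one_pos, fun p hp _ h => ?_⟩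
    exact (hs.le_of_mem_closure hU h.1).not_gt hp

theorem isOpen_seq (hU : IsCanonicalSeq U) (hs : IsSlicer U s) (α : Omega1) :
    IsOpen (seq s U α) := by
  refine isOpen_glue ((hU.isTypeISeq.isOpen α).prod isOpen_univ) fun x hx => ?_
  refine ⟨_, isOpen_Iio, hx, subset_rfl, 0, le_rfl, one_pos, fun p hp _ => ⟨?_, trivial⟩⟩
  by_contra h
  exact (hs.le_of_notMem hU h).not_gt hp

theorem isTypeISeq_seq (hU : IsCanonicalSeq U) (hs : IsSlicer U s) :
    IsTypeISeq (seq s U) where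
  iUnion_eq := by
    refine eq_univ_of_forall fun z => mem_iUnion.2 ?_
    rcases body_or_core z with ⟨p, rfl⟩ | ⟨x, rfl⟩
    · obtain ⟨α, hα⟩ := hU.isTypeISeq.exists_mem p.1
      exact ⟨α, body_mem_glue.2 ⟨hα, trivial⟩⟩
    · exact ⟨_, core_mem_glue.2 x.lt_ofOmega1_succ⟩
  isOpen := isOpen_seq hU hs
  isLindelof_closure α := by
    have h1 : IsLindelof (cyl s '' (closure (U α) ×ˢ univ) ∪ core '' Iic (LongRay.ofOmega1 α)) :=
      (((hU.isTypeISeq.isLindelof_closure α).prod_isCompact isCompact_univ).image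
        (continuous_cyl hs.continuous)).union
        ((LongRay.isCompact_Iic _).isLindelof.image continuous_core)
    exact h1.of_isClosed_subset isClosed_closure
      ((closure_seq_subset hU hs α).trans (glue_subset_cyl _ _))
  closure_subset α β h := by
    refine (closure_seq_subset hU hs α).trans ?_
    exact union_subset_union
      (image_mono (prod_mono (hU.isTypeISeq.closure_subset α β h) subset_rfl))
      (image_mono (Iic_subset_Iio.2 (LongRay.ofOmega1_strictMono h)))

theorem isTypeI [T3Space X] (hU : IsCanonicalSeq U) (hs : IsSlicer U s) :
    IsTypeI (SigmaSpace s) where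
  t2 := have := SigmaSpace.t3Space hs.continuous; inferInstance
  not_lindelof := (isTypeISeq_seq hU hs).not_lindelofSpace fun α => ⟨_, core_notMem_seq α⟩
  exists_seq := ⟨_, isTypeISeq_seq hU hs⟩

theorem isOmegaBounded (hU : IsCanonicalSeq U) (hs : IsSlicer U s) (hX : IsOmegaBounded X) :
    IsOmegaBounded (SigmaSpace s) := fun A hA => by
  obtain ⟨α, hα⟩ := (isTypeISeq_seq hU hs).exists_superset_of_countable hA
  have hK := hX.isCompact_of_isLindelof (hU.isTypeISeq.isLindelof_closure α) isClosed_closure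
  have h1 : IsCompact (cyl s '' (closure (U α) ×ˢ univ) ∪ core '' Iic (LongRay.ofOmega1 α)) :=
    ((hK.prod isCompact_univ).image (continuous_cyl hs.continuous)).union
      ((LongRay.isCompact_Iic _).image continuous_core)
  exact h1.of_isClosed_subset isClosed_closure (((closure_mono hα).trans
    (closure_seq_subset hU hs α)).trans (glue_subset_cyl _ _))

/-! #### Local metrizability -/

/-- The countable base consists of a countable base of `U α × [0, 1)` and of the sets `W(v, q)`,
with `v` in a countable base of the ray below `α` and `q` rational. With regularity, this makes the
members of the sequence metrizable. -/
theorem secondCountable_seq (hU : IsCanonicalSeq U) (hs : IsSlicer U s) {α : Omega1}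
    (h2 : SecondCountableTopology (U α)) : SecondCountableTopology (seq s U α) := by
  let e : U α × Set.Ico (0 : ℝ) 1 → SigmaSpace s := fun p => body (p.1, p.2)
  have he : IsOpenEmbedding e := isOpenEmbedding_body.comp
    ((hU.isTypeISeq.isOpen α).isOpenEmbedding_subtypeVal.prodMap .id)
  let B₁ : Set (Set (seq s U α)) := (fun B => Subtype.val ⁻¹' (e '' B)) ''
    TopologicalSpace.countableBasis (U α × Set.Ico (0 : ℝ) 1)
  let B₂ : Set (Set (seq s U α)) := image2 (fun v (q : ℚ) => Subtype.val ⁻¹' coreNhd s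
    (Subtype.val '' v) q) (TopologicalSpace.countableBasis (Iio (LongRay.ofOmega1 α)))
    {q : ℚ | 0 ≤ (q : ℝ) ∧ (q : ℝ) < 1}
  have hB₁ : B₁.Countable := (TopologicalSpace.countable_countableBasis _).image _
  have hB₂ : B₂.Countable := (TopologicalSpace.countable_countableBasis _).image2
    (to_countable _) _
  refine (TopologicalSpace.isTopologicalBasis_of_isOpen_of_nhds (s := B₁ ∪ B₂) ?_
    ?_).secondCountableTopology (hB₁.union hB₂)
  · rintro _ (⟨B, hB, rfl⟩ | ⟨v, hv, q, hq, rfl⟩)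
    · exact (he.isOpenMap _ (TopologicalSpace.isOpen_of_mem_countableBasis hB)).preimage
        continuous_subtype_val
    · exact (isOpen_coreNhd hs.continuous (isOpen_Iio.isOpenMap_subtype_val _
        (TopologicalSpace.isOpen_of_mem_countableBasis hv)) hq.1 hq.2).preimage
        continuous_subtype_val
  · rintro ⟨z, hz⟩ G hzG hG
    obtain ⟨G', hG', rfl⟩ := isOpen_induced_iff.1 hG
    rcases body_or_core z with ⟨p, rfl⟩ | ⟨x, rfl⟩
    · have hp : p.1 ∈ U α := (body_mem_glue.1 hz).1
      obtain ⟨B, hB, hpB, hBG⟩ := (TopologicalSpace.isBasis_countableBasis _).exists_subset_of_mem_open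
        (show ((⟨p.1, hp⟩, p.2) : U α × Set.Ico (0 : ℝ) 1) ∈ e ⁻¹' G' from hzG)
        (hG'.preimage he.continuous)
      refine ⟨_, Or.inl ⟨B, hB, rfl⟩, ⟨_, hpB, rfl⟩, ?_⟩
      rintro ⟨_, _⟩ ⟨y, hy, rfl⟩
      exact hBG hy
    · have hx : x ∈ Iio (LongRay.ofOmega1 α) := core_mem_glue.1 hz
      obtain ⟨V, hV, hxV, a, ha0, ha1, hVG⟩ := (isOpen_iff.1 hG').2 x hzG
      obtain ⟨v, hv, hxv, hvV⟩ := (TopologicalSpace.isBasis_countableBasis _).exists_subset_of_mem_open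
        (show (⟨x, hx⟩ : Iio (LongRay.ofOmega1 α)) ∈ Subtype.val ⁻¹' V from hxV)
        (hV.preimage continuous_subtype_val)
      obtain ⟨q, haq, hq⟩ := exists_rat_btwn ha1
      refine ⟨_, Or.inr ⟨v, hv, q, ⟨ha0.trans haq.le, hq⟩, rfl⟩, Or.inl ⟨x, ⟨_, hxv, rfl⟩, rfl⟩,
        fun y hy => hVG ?_⟩
      rcases hy with ⟨w, ⟨w', hw, rfl⟩, hwy⟩ | ⟨p, ⟨⟨w', hw, hwp⟩, hap⟩, hpy⟩
      · exact Or.inl ⟨_, hvV hw, hwy⟩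
      · exact Or.inr ⟨p, ⟨hwp ▸ hvV hw, haq.trans hap⟩, hpy⟩

theorem isLocallyMetrizable [T3Space X] (hU : IsCanonicalSeq U) (hs : IsSlicer U s)
    (h2 : ∀ α, SecondCountableTopology (U α)) : IsLocallyMetrizable (SigmaSpace s) := fun z => by
  have := SigmaSpace.t3Space hs.continuous
  obtain ⟨α, hα⟩ := (isTypeISeq_seq hU hs).exists_mem z
  have := secondCountable_seq hU hs (h2 α)
  exact ⟨_, isOpen_seq hU hs α, hα, inferInstance⟩

theorem isLocallySeparable (hU : IsCanonicalSeq U) (hs : IsSlicer U s)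
    (h2 : ∀ α, SecondCountableTopology (U α)) : IsLocallySeparable (SigmaSpace s) := fun z => by
  obtain ⟨α, hα⟩ := (isTypeISeq_seq hU hs).exists_mem z
  have := secondCountable_seq hU hs (h2 α)
  exact ⟨_, isOpen_seq hU hs α, hα, inferInstance⟩

end SigmaSpace

/-! ### Homotopies into the long ray -/

/-- Homotopies of maps to the long ray preserve boundedness and properness. -/
def HomotopyRigid {X : Type*} [TopologicalSpace X] (U : Omega1 → Set X) : Prop :=
  ∀ f : X × unitInterval → LongRay, Continuous f →
    (BddAbove (range fun x => f (x, 1)) → BddAbove (range f)) ∧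
    ((∀ c, ∃ α, {x | f (x, 1) ≤ c} ⊆ U α) → ∀ c, ∃ α, {x | ∃ t, f (x, t) ≤ c} ⊆ U α)

namespace SigmaSpace

variable {X : Type*} [TopologicalSpace X] {s : X → LongRay} {U : Omega1 → Set X}

/-- At time 1 the homotopy `f ∘ cyl s` equals `f ∘ core ∘ s`, so the dichotomy bounded/proper for
the self-map `f ∘ core` of the ray spreads over the whole space by rigidity. -/
theorem isDirectionInItself (hU : IsCanonicalSeq U) (hs : IsSlicer U s) (hr : HomotopyRigid U) :
    IsDirectionInItself (SigmaSpace s) := by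
  have hseq := isTypeISeq_seq hU hs
  refine ⟨⟨isClosed_univ, ?_⟩, fun C _ hC => ⟨fun f hf hfu hfC => ?_,
    fun f _ hfC hfu => hfC (hfu.mono (image_mono (subset_univ _)))⟩⟩
  · rw [isBoundedSet_iff hseq]
    rintro ⟨α, hα⟩
    exact core_notMem_seq α (hα trivial)
  · obtain ⟨h1, h2⟩ := hr (f ∘ cyl s) (hf.comp (continuous_cyl hs.continuous))
    simp only [Function.comp_apply, cyl_one] at h1 h2
    by_cases hcore : BddAbove (range (f ∘ core))
    · obtain ⟨b, hb⟩ := h1 (hcore.mono (by rintro _ ⟨x, rfl⟩; exact ⟨s x, rfl⟩))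
      obtain ⟨b', hb'⟩ := hcore
      refine hfu ⟨max b b', ?_⟩
      rintro _ ⟨z, -, rfl⟩
      rcases body_or_core z with ⟨p, rfl⟩ | ⟨x, rfl⟩
      · rw [body_eq_cyl]
        exact (hb ⟨_, rfl⟩).trans (le_max_left _ _)
      · exact (hb' ⟨x, rfl⟩).trans (le_max_right _ _)
    · have hp := LongRay.bddAbove_preimage_Iic (hf.comp continuous_core) hcore
      obtain ⟨c, hc⟩ := hfC
      -- Properness of `f ∘ core` bounds `s x`, and a slicer is large outside each `U α`. So the
      -- homotopy is proper at time 1.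
      obtain ⟨α, hα⟩ := h2 (fun c => by
        obtain ⟨d, hd⟩ := hp c
        refine ⟨Order.succ d.idx, fun x hx => ?_⟩
        by_contra hxU
        exact ((hs.le_of_notMem hU hxU).trans (hd hx)).not_gt d.lt_ofOmega1_succ) c
      obtain ⟨d, hd⟩ := hp c
      refine hC.2 ((isBoundedSet_iff hseq C).2 ⟨max α (Order.succ d.idx), fun z hz => ?_⟩)
      have hfz : f z ≤ c := hc ⟨z, hz, rfl⟩
      rcases body_or_core z with ⟨p, rfl⟩ | ⟨x, rfl⟩
      · refine body_mem_glue.2 ⟨hU.isTypeISeq.mono (le_max_left _ _) (hα ?_), trivial⟩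
        rw [body_eq_cyl] at hfz
        exact ⟨_, hfz⟩
      · refine core_mem_glue.2 ((hd hfz).trans_lt (d.lt_ofOmega1_succ.trans_le ?_))
        exact LongRay.ofOmega1_le_ofOmega1.2 (le_max_right _ _)

/-- The bottom of `Σ(X, s)`, a closed copy of `X`. -/
def bottom (s : X → LongRay) (x : X) : SigmaSpace s := body (x, ⟨0, by norm_num⟩)

theorem isEmbedding_bottom : IsEmbedding (bottom s) :=
  isOpenEmbedding_body.isEmbedding.comp (isEmbedding_prodMkLeft _)

theorem isClosed_range_bottom [T1Space X] : IsClosed (range (bottom s)) := by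
  have h : range (bottom s) = glue s {p | p.2 = ⟨0, by norm_num⟩} ∅ := by
    ext z
    rcases body_or_core z with ⟨p, rfl⟩ | ⟨x, rfl⟩
    · simp only [mem_range, body_mem_glue, bottom, body_injective.eq_iff, Prod.ext_iff]
      simp [eq_comm]
    · simp only [mem_range, core_mem_glue, bottom, body_ne_core]
      simp
  rw [h]
  exact isClosed_body_le (isClosed_eq continuous_snd continuous_const) le_rfl one_pos
    (by rintro p (hp : p.2 = _); rw [hp])

/-- The club is the bottom. A map on `X` separating a club `D` from a club inside it restricts to
`D`; failing to be a direction in `X` is thus inherited by the subspace. -/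
theorem exists_containsNoDirectionInItself [T1Space X] (hX : IsTypeI X) (hU : IsCanonicalSeq U)
    (hs : IsSlicer U s) (hN : ContainsNoDirection X) :
    ∃ C : Set (SigmaSpace s), IsClubSubset C ∧ ContainsNoDirectionInItself C := by
  have hseq := isTypeISeq_seq hU hs
  refine ⟨range (bottom s), ⟨isClosed_range_bottom, ?_⟩, fun D hDC hD hdir => ?_⟩
  · rw [isBoundedSet_iff hseq]
    rintro ⟨α, hα⟩
    obtain ⟨x, hx⟩ := hX.exists_notMem hU.isTypeISeq α
    exact hx (body_mem_glue.1 (hα (mem_range_self x))).1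
  · have hD' : IsClubSubset (bottom s ⁻¹' D) := by
      refine ⟨hD.1.preimage isEmbedding_bottom.continuous, fun hb => hD.2 ?_⟩
      obtain ⟨α, hα⟩ := (isBoundedSet_iff hU.isTypeISeq _).1 hb
      refine (isBoundedSet_iff hseq _).2 ⟨α, fun z hz => ?_⟩
      obtain ⟨x, rfl⟩ := hDC hz
      exact body_mem_glue.2 ⟨hα hz, trivial⟩
    have h := hN (bottom s ⁻¹' D)
    simp only [IsDirection, hD', true_and, not_forall] at h
    obtain ⟨C', hC'D, hC', hne⟩ := h
    have h1 : ¬ UfoLE (bottom s ⁻¹' D) C' := fun h => hne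
      ⟨h, fun f _ hf hf' => hf (hf'.mono (image_mono hC'D))⟩
    simp only [UfoLE, not_forall, not_not] at h1
    obtain ⟨f, hf, hfD, hfC⟩ := h1
    -- `pr` identifies `D` with a subset of `X`. Sets bounded in the subspace `D` have bounded
    -- image, since they lie in Lindelöf sets, so `C'` is still a club inside `D`.
    choose pr hpr using fun d : D => hDC d.2
    have hprc : Continuous pr := isEmbedding_bottom.continuous_iff.2 (by
      have : bottom s ∘ pr = Subtype.val := funext hpr
      rw [this]
      exact continuous_subtype_val)
    have hpr' : ∀ x (hx : bottom s x ∈ D), pr ⟨_, hx⟩ = x := fun x hx =>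
      isEmbedding_bottom.injective (hpr ⟨_, hx⟩)
    have hclub : IsClubSubset (pr ⁻¹' C') := by
      refine ⟨hC'.1.preimage hprc, fun hb => hC'.2 ?_⟩
      obtain ⟨α, hα⟩ := hb.exists_image_subset hU.isTypeISeq hprc
      refine (isBoundedSet_iff hU.isTypeISeq _).2 ⟨α, fun x hx => ?_⟩
      have h3 := hpr' x (hC'D hx)
      exact hα ⟨⟨_, hC'D hx⟩, by rwa [mem_preimage, h3], h3⟩
    refine (hdir.2 _ (subset_univ _) hclub).1 (f ∘ pr) (hf.comp hprc) (fun hb => hfD ?_) ?_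
    · refine hb.mono ?_
      rintro _ ⟨x, hx, rfl⟩
      exact ⟨⟨_, hx⟩, trivial, congrArg f (hpr' x hx)⟩
    · refine hfC.mono ?_
      rintro _ ⟨d, hd, rfl⟩
      exact ⟨pr d, hd, rfl⟩

end SigmaSpace

/-! ### Homotopies on countably compact spaces -/

theorem IsClosed.exists_mem_of_isCompact {X Y : Type*} [TopologicalSpace X] [TopologicalSpace Y]
    {F : Set (X × Y)} (hF : IsClosed F) {T : Set Y} (hT : IsCompact T) :
    IsClosed {x | ∃ t ∈ T, (x, t) ∈ F} := by
  have : CompactSpace T := isCompact_iff_compactSpace.1 hT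
  have h := isClosedMap_fst_of_compactSpace (X := X) (Y := T) _
    (hF.preimage (f := fun p : X × T => (p.1, (p.2 : Y))) (by fun_prop))
  convert h using 1
  ext x
  simp

section CountablyCompact

variable {X : Type*} [TopologicalSpace X] {f : X × ℝ → LongRay}

/-- The path of each point of `K` over `[a, b]` comes below a fixed bound, but the paths are
not uniformly bounded. -/
structure IsOscillating (f : X × ℝ → LongRay) (K : Set X) (a b : ℝ) : Prop where
  isClosed : IsClosed K
  le : a ≤ b
  exists_le : ∃ c, ∀ x ∈ K, ∃ t ∈ Icc a b, f (x, t) ≤ c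
  unbounded : ∀ d, ∃ x ∈ K, ∃ t ∈ Icc a b, d < f (x, t)

theorem IsOscillating.exists_half (hf : Continuous f) {K : Set X} {a b : ℝ}
    (h : IsOscillating f K a b) : ∃ K' a' b', IsOscillating f K' a' b' ∧ K' ⊆ K ∧
      a ≤ a' ∧ b' ≤ b ∧ b' - a' = (b - a) / 2 := by
  obtain ⟨c, hc⟩ := h.exists_le
  let m := (a + b) / 2
  have ham : a ≤ m := by simp only [m]; linarith [h.le]
  have hmb : m ≤ b := by simp only [m]; linarith [h.le]
  by_contra! hcon
  have hcl : ∀ u v, IsClosed {x | x ∈ K ∧ ∃ t ∈ Icc u v, f (x, t) ≤ c} := fun u v =>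
    h.isClosed.inter ((isClosed_Iic.preimage hf).exists_mem_of_isCompact isCompact_Icc)
  -- If no half interval oscillates, then over such an interval paths that come below a fixed bound
  -- are uniformly bounded.
  have key : ∀ K' ⊆ K, IsClosed K' → ∀ u v, a ≤ u → v ≤ b → u ≤ v → v - u = (b - a) / 2 →
      (∃ c, ∀ x ∈ K', ∃ t ∈ Icc u v, f (x, t) ≤ c) →
      ∃ d, ∀ x ∈ K', ∀ t ∈ Icc u v, f (x, t) ≤ d := by
    intro K' hK' hK'c u v hau hvb huv hlen hlow
    by_contra! hub
    exact hcon K' u v ⟨hK'c, huv, hlow, hub⟩ hK' hau hvb hlen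
  have halves : ∀ K' ⊆ K, IsClosed K' → ((∃ c, ∀ x ∈ K', ∃ t ∈ Icc a m, f (x, t) ≤ c) ∨
      (∃ c, ∀ x ∈ K', ∃ t ∈ Icc m b, f (x, t) ≤ c)) →
      ∃ d, ∀ x ∈ K', ∀ t ∈ Icc a b, f (x, t) ≤ d := by
    intro K' hK' hK'c hlow
    have k1 := key K' hK' hK'c a m le_rfl hmb ham (by simp only [m]; ring)
    have k2 := key K' hK' hK'c m b ham le_rfl hmb (by simp only [m]; ring)
    -- A uniform bound over one half bounds the values at the midpoint, which is a low visit in the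
    -- other half.
    have both : (∃ d, ∀ x ∈ K', ∀ t ∈ Icc a m, f (x, t) ≤ d) ∧
        ∃ d, ∀ x ∈ K', ∀ t ∈ Icc m b, f (x, t) ≤ d := by
      rcases hlow with hlow | hlow
      · obtain ⟨d, hd⟩ := k1 hlow
        exact ⟨⟨d, hd⟩, k2 ⟨d, fun x hx => ⟨m, ⟨le_rfl, hmb⟩, hd x hx m ⟨ham, le_rfl⟩⟩⟩⟩
      · obtain ⟨d, hd⟩ := k2 hlow
        exact ⟨k1 ⟨d, fun x hx => ⟨m, ⟨ham, le_rfl⟩, hd x hx m ⟨le_rfl, hmb⟩⟩⟩, ⟨d, hd⟩⟩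
    obtain ⟨⟨d, hd⟩, d', hd'⟩ := both
    refine ⟨max d d', fun x hx t ht => ?_⟩
    rcases le_total t m with htm | htm
    · exact (hd x hx t ⟨ht.1, htm⟩).trans (le_max_left _ _)
    · exact (hd' x hx t ⟨htm, ht.2⟩).trans (le_max_right _ _)
  -- `K` is the union of two closed sets, according to the half in which a path comes below `c`;
  -- both would have bounded paths.
  obtain ⟨d₁, h₁⟩ := halves _ (fun x hx => hx.1) (hcl a m) (Or.inl ⟨c, fun x hx => hx.2⟩)
  obtain ⟨d₂, h₂⟩ := halves _ (fun x hx => hx.1) (hcl m b) (Or.inr ⟨c, fun x hx => hx.2⟩)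
  obtain ⟨x, hx, t, ht, hlt⟩ := h.unbounded (max d₁ d₂)
  obtain ⟨u, hu, huc⟩ := hc x hx
  rcases le_total u m with hum | hum
  · exact (((le_max_left _ _).trans_lt hlt)).not_ge (h₁ x ⟨hx, u, ⟨hu.1, hum⟩, huc⟩ t ht)
  · exact (((le_max_right _ _).trans_lt hlt)).not_ge (h₂ x ⟨hx, u, ⟨hum, hu.2⟩, huc⟩ t ht)

theorem IsOscillating.false [CountablyCompactSpace X] (hf : Continuous f) {K : Set X} {a b : ℝ}
    (h : IsOscillating f K a b) : False := by
  let S := {σ : Set X × ℝ × ℝ // IsOscillating f σ.1 σ.2.1 σ.2.2}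
  have step : ∀ σ : S, ∃ τ : S, τ.1.1 ⊆ σ.1.1 ∧ σ.1.2.1 ≤ τ.1.2.1 ∧ τ.1.2.2 ≤ σ.1.2.2 ∧
      τ.1.2.2 - τ.1.2.1 = (σ.1.2.2 - σ.1.2.1) / 2 := fun σ => by
    obtain ⟨K', a', b', h', h1⟩ := σ.2.exists_half hf
    exact ⟨⟨(K', a', b'), h'⟩, h1⟩
  choose g hgK hga hgb hglen using step
  let σ : ℕ → S := fun n => g^[n] ⟨(K, a, b), h⟩
  have hσ : ∀ n, σ (n + 1) = g (σ n) := fun n => Function.iterate_succ_apply' g n _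
  let Kn : ℕ → Set X := fun n => (σ n).1.1
  let A : ℕ → ℝ := fun n => (σ n).1.2.1
  let B : ℕ → ℝ := fun n => (σ n).1.2.2
  have hosc : ∀ n, IsOscillating f (Kn n) (A n) (B n) := fun n => (σ n).2
  have hK : Antitone Kn := antitone_nat_of_succ_le fun n => by
    simp only [Kn, hσ]; exact hgK _
  have hA : Monotone A := monotone_nat_of_le_succ fun n => by
    simp only [A, hσ]; exact hga _
  have hB : Antitone B := antitone_nat_of_succ_le fun n => by
    simp only [B, hσ]; exact hgb _
  have hlen : ∀ n, B n - A n = (b - a) * (1 / 2) ^ n := by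
    intro n
    induction n with
    | zero => simp [A, B, σ]
    | succ n ih =>
      have : B (n + 1) - A (n + 1) = (B n - A n) / 2 := by
        simp only [A, B, hσ]; exact hglen _
      rw [this, ih]
      ring
  choose c hc using fun n => (hosc n).exists_le
  -- One bound serves all stages because countable subsets of the ray are bounded. A point common to
  -- all `G n` has a path that is at most `c'` and at least `d > c'` at times converging to the same
  -- limit.
  obtain ⟨c', hc'⟩ := LongRay.exists_upper c
  obtain ⟨d, hd⟩ := exists_gt c'
  let G : ℕ → Set X := fun n => Kn n ∩ ({x | ∃ t ∈ Icc (A n) (B n), (x, t) ∈ f ⁻¹' Iic c'} ∩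
    {x | ∃ t ∈ Icc (A n) (B n), (x, t) ∈ f ⁻¹' Ici d})
  obtain ⟨x, hx⟩ := exists_forall_mem_of_antitone (G := G)
    (fun n => (hosc n).isClosed.inter
      (((isClosed_Iic.preimage hf).exists_mem_of_isCompact isCompact_Icc).inter
        ((isClosed_Ici.preimage hf).exists_mem_of_isCompact isCompact_Icc)))
    (fun n => by
      obtain ⟨x, hx, t, ht, hlt⟩ := (hosc n).unbounded d
      obtain ⟨u, hu, huc⟩ := hc n x hx
      exact ⟨x, hx, ⟨u, hu, huc.trans (hc' n).le⟩, ⟨t, ht, hlt.le⟩⟩)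
    (fun n m hnm x hx => by
      obtain ⟨hx, ⟨u, hu, huc⟩, ⟨t, ht, htd⟩⟩ := hx
      have hI : Icc (A m) (B m) ⊆ Icc (A n) (B n) := Icc_subset_Icc (hA hnm) (hB hnm)
      exact ⟨hK hnm hx, ⟨u, hI hu, huc⟩, ⟨t, hI ht, htd⟩⟩)
  have hAB : ∀ n m, A n ≤ B m := fun n m =>
    (hA (le_max_left n m)).trans ((hosc _).le.trans (hB (le_max_right n m)))
  have htA := tendsto_atTop_ciSup hA ⟨B 0, by rintro _ ⟨n, rfl⟩; exact hAB n 0⟩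
  have htB : Filter.Tendsto B Filter.atTop (𝓝 (⨆ n, A n)) := by
    have h0 : Filter.Tendsto (fun n => (b - a) * (1 / 2 : ℝ) ^ n) Filter.atTop (𝓝 0) := by
      simpa using (tendsto_pow_atTop_nhds_zero_of_lt_one (r := (1 / 2 : ℝ)) (by norm_num)
        (by norm_num)).const_mul (b - a)
    have := htA.add h0
    simp only [← hlen, add_sub_cancel, add_zero] at this
    exact this
  choose u hu huc using fun n => (hx n).2.1
  choose t ht htd using fun n => (hx n).2.2
  have hlim : ∀ v : ℕ → ℝ, (∀ n, v n ∈ Icc (A n) (B n)) →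
      Filter.Tendsto (fun n => f (x, v n)) Filter.atTop (𝓝 (f (x, ⨆ n, A n))) := fun v hv =>
    ((hf.comp (Continuous.prodMk_right x)).tendsto _).comp
      (tendsto_of_tendsto_of_tendsto_of_le_of_le htA htB (fun n => (hv n).1) fun n => (hv n).2)
  have e1 : f (x, ⨆ n, A n) ≤ c' := le_of_tendsto' (hlim u hu) huc
  have e2 : d ≤ f (x, ⨆ n, A n) := ge_of_tendsto' (hlim t ht) htd
  exact (hd.trans_le (e2.trans e1)).false

theorem CountablyCompactSpace.homotopyRigid [CountablyCompactSpace X] (U : Omega1 → Set X) :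
    HomotopyRigid U := by
  intro f hf
  let g : X × ℝ → LongRay := fun p => f (p.1, projIcc 0 1 zero_le_one p.2)
  have hg : Continuous g := hf.comp (by fun_prop)
  have hgt : ∀ x (t : unitInterval), g (x, t) = f (x, t) := fun x t => by simp [g]
  have key : ∀ K : Set X, IsClosed K → ∀ c, (∀ x ∈ K, ∃ t, f (x, t) ≤ c) →
      ∃ d, ∀ x ∈ K, ∀ t, f (x, t) ≤ d := by
    intro K hK c hc
    by_contra! hcon
    refine IsOscillating.false hg (K := K) (a := 0) (b := 1) ⟨hK, zero_le_one, ⟨c, fun x hx => ?_⟩,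
      fun d => ?_⟩
    · obtain ⟨t, ht⟩ := hc x hx
      exact ⟨t, t.2, by rwa [hgt]⟩
    · obtain ⟨x, hx, t, ht⟩ := hcon d
      exact ⟨x, hx, t, t.2, by rwa [hgt]⟩
  refine ⟨fun ⟨c, hc⟩ => ?_, fun hprop c => ?_⟩
  · obtain ⟨d, hd⟩ := key univ isClosed_univ c fun x _ => ⟨1, hc ⟨x, rfl⟩⟩
    exact ⟨d, by rintro _ ⟨⟨x, t⟩, rfl⟩; exact hd x trivial t⟩
  -- On the closed set of points whose path comes below `c`, paths are bounded by some `d`, in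
  -- particular at time 1, where properness applies.
  · have hcl : IsClosed {x | ∃ t, f (x, t) ≤ c} := by
      simpa using (isClosed_Iic.preimage hf).exists_mem_of_isCompact (isCompact_univ)
    obtain ⟨d, hd⟩ := key _ hcl c fun x hx => hx
    obtain ⟨α, hα⟩ := hprop d
    exact ⟨α, fun x hx => hα (hd x hx 1)⟩

end CountablyCompact

/-! ### Splitting a club -/

section Split

variable {X : Type*} [TopologicalSpace X] {U : Omega1 → Set X} {s : X → LongRay}

theorem IsSlicer.not_bddAbove_image (hU : IsCanonicalSeq U) (hs : IsSlicer U s) {A : Set X}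
    (hA : ¬ IsBoundedSet A) : ¬ BddAbove (s '' A) := by
  rintro ⟨c, hc⟩
  refine hA ((isBoundedSet_iff hU.isTypeISeq A).2 ⟨Order.succ c.idx, fun x hx => ?_⟩)
  by_contra hxU
  exact ((hs.le_of_notMem hU hxU).trans (hc ⟨x, hx, rfl⟩)).not_gt c.lt_ofOmega1_succ

/-- A set which is split by a clopen set into two unbounded pieces is not a direction. -/
theorem IsClopen.not_isDirection (hU : IsCanonicalSeq U) (hs : IsSlicer U s) {D E : Set X}
    (hE : IsClopen E) (h1 : ¬ IsBoundedSet (D ∩ E)) (h2 : ¬ IsBoundedSet (D ∩ Eᶜ)) :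
    ¬ IsDirection D := fun hD => by
  classical
  let z : LongRay := Classical.arbitrary _
  have hf : Continuous (E.piecewise s fun _ => z) :=
    hs.continuous.piecewise (by simp [hE.frontier_eq]) continuous_const
  refine (hD.2 (D ∩ Eᶜ) inter_subset_left ⟨hD.1.1.inter hE.compl.1, h2⟩).1 _ hf ?_ ⟨z, ?_⟩
  · refine fun hb => hs.not_bddAbove_image hU h1 (hb.mono ?_)
    rintro _ ⟨x, hx, rfl⟩
    exact ⟨x, hx.1, piecewise_eq_of_mem _ _ _ hx.2⟩
  · rintro _ ⟨x, hx, rfl⟩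
    exact (piecewise_eq_of_notMem _ _ _ hx.2).le

end Split

/-! ### Spaces with a height function -/

section Height

variable {X : Type*} [TopologicalSpace X] {h : X → Omega1}

theorem isOpen_setOf_height_lt (hcl : ∀ α, IsClopen {x | h x ≤ α}) (α : Omega1) :
    IsOpen {x | h x < α} := by
  have : {x | h x < α} = ⋃ β, ⋃ (_ : β < α), {x | h x ≤ β} := by
    ext x
    simp only [mem_iUnion, exists_prop]
    exact ⟨fun hx => ⟨h x, hx, le_refl (h x)⟩, fun ⟨β, hβ, hx⟩ => lt_of_le_of_lt hx hβ⟩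
  rw [this]
  exact isOpen_biUnion fun β _ => (hcl β).2

theorem closure_setOf_height_lt_subset (hcl : ∀ α, IsClopen {x | h x ≤ α}) (α : Omega1) :
    closure {x | h x < α} ⊆ {x | h x ≤ α} :=
  closure_minimal (fun x (hx : h x < α) => (hx.le : h x ≤ α)) (hcl α).1

theorem isCanonicalSeq_height (hcl : ∀ α, IsClopen {x | h x ≤ α})
    (hL : ∀ α, IsLindelof {x | h x ≤ α}) : IsCanonicalSeq fun α => {x | h x < α} where
  isTypeISeq :=
    { iUnion_eq := eq_univ_of_forall fun x => mem_iUnion.2 ⟨_, Order.lt_succ (h x)⟩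
      isOpen := isOpen_setOf_height_lt hcl
      isLindelof_closure := fun α => (hL α).of_isClosed_subset isClosed_closure
        (closure_setOf_height_lt_subset hcl α)
      closure_subset := fun α _ hαβ => (closure_setOf_height_lt_subset hcl α).trans
        fun _ hx => lt_of_le_of_lt hx hαβ }
  eq_iUnion α hα := by
    ext x
    simp only [mem_iUnion, exists_prop]
    exact ⟨fun hx => ⟨_, hα.succ_lt hx, Order.lt_succ (h x)⟩, fun ⟨β, hβ, hx⟩ => lt_trans hx hβ⟩

theorem isSlicer_height (hcl : ∀ α, IsClopen {x | h x ≤ α}) :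
    IsSlicer (fun α => {x | h x < α}) fun x => LongRay.ofOmega1 (h x) where
  continuous := by
    refine OrderTopology.continuous_iff.2 fun a => ⟨?_, ?_⟩
    · convert (hcl a.idx).compl.2 using 1
      ext x
      simp [LongRay.lt_ofOmega1]
    · by_cases h0 : LongRay.ofOmega1 a.idx < a
      · convert (hcl a.idx).2 using 1
        ext x
        simp only [mem_preimage, mem_Iio]
        refine ⟨fun hx => LongRay.idx_mono hx.le, fun hx => lt_of_le_of_lt ?_ h0⟩
        exact LongRay.ofOmega1_le_ofOmega1.2 hx
      · have ha : a = LongRay.ofOmega1 a.idx :=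
          le_antisymm (not_lt.1 h0) (LongRay.ofOmega1_le.2 le_rfl)
        convert isOpen_setOf_height_lt hcl a.idx using 1
        ext x
        simp only [mem_preimage, mem_Iio]
        conv_lhs => rw [ha]
        exact LongRay.ofOmega1_lt_ofOmega1
  mem_Icc := by
    rintro α x ⟨hx, hx'⟩
    have h1 : α ≤ h x := not_lt.1 hx'
    have h2 : h x ≤ α := closure_minimal
      (fun y (hy : h y < Order.succ α) => (Order.lt_succ_iff.1 hy : h y ≤ α)) (hcl α).1 hx
    exact ⟨LongRay.ofOmega1_le_ofOmega1.2 h1,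
      LongRay.ofOmega1_le_ofOmega1.2 (h2.trans (Order.le_succ α))⟩

theorem isTypeI_height [T2Space X] (hcl : ∀ α, IsClopen {x | h x ≤ α})
    (hL : ∀ α, IsLindelof {x | h x ≤ α}) (hunb : ∀ α, ∃ x, α ≤ h x) : IsTypeI X where
  t2 := inferInstance
  not_lindelof := (isCanonicalSeq_height hcl hL).isTypeISeq.not_lindelofSpace fun α =>
    (hunb α).imp fun _ hx => not_lt.2 hx
  exists_seq := ⟨_, (isCanonicalSeq_height hcl hL).isTypeISeq⟩

theorem not_isBoundedSet_height (hcl : ∀ α, IsClopen {x | h x ≤ α})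
    (hL : ∀ α, IsLindelof {x | h x ≤ α}) {A : Set X} :
    ¬ IsBoundedSet A ↔ ∀ α, ∃ x ∈ A, α ≤ h x := by
  rw [isBoundedSet_iff (isCanonicalSeq_height hcl hL).isTypeISeq]
  simp only [not_exists, not_subset]
  simp

end Height

/-! ### Ultrafilters on `ω₁` concentrating on a countable set -/

/-- There is a sequence of ordinals along which a given function is overtaken. -/
theorem Omega1.exists_overtaking (g : Omega1 → Omega1) :
    ∃ b : Omega1 → Omega1, ∀ η ξ, η < ξ → g (b η) < b ξ := by
  have hub : ∀ (ξ : Omega1) (r : Iio ξ → Omega1), ∃ β, ∀ i, g (r i) < β := fun ξ r => by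
    have := (Omega1.countable_Iio ξ).to_subtype
    exact Omega1.exists_upper _
  choose u hu using hub
  have hwf := wellFounded_lt (α := Omega1)
  -- Recursion: `b ξ` is chosen above the countably many values `g (b η)` with `η < ξ`.
  refine ⟨hwf.fix fun ξ ih => u ξ fun i => ih i.1 i.2, fun η ξ h => ?_⟩
  rw [hwf.fix_eq _ ξ]
  exact hu ξ (fun i => hwf.fix (fun ξ ih => u ξ fun i => ih i.1 i.2) i.1) ⟨η, h⟩

/-- The space of ultrafilters on `ω₁` which contain a countable set. -/
def BoundedUltrafilter : Type := {p : Ultrafilter Omega1 // ∃ α, Iic α ∈ p}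

namespace BoundedUltrafilter

instance : TopologicalSpace BoundedUltrafilter :=
  inferInstanceAs (TopologicalSpace {p : Ultrafilter Omega1 // ∃ α, Iic α ∈ p})

instance : T3Space BoundedUltrafilter :=
  inferInstanceAs (T3Space {p : Ultrafilter Omega1 // ∃ α, Iic α ∈ p})

/-- The limit of the identity along an ultrafilter. -/
noncomputable def height (p : BoundedUltrafilter) : Omega1 := (Omega1.exists_isLeast p.2).choose

theorem height_le_iff {p : BoundedUltrafilter} {α : Omega1} : p.height ≤ α ↔ Iic α ∈ p.1 :=
  have h := (Omega1.exists_isLeast p.2).choose_spec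
  ⟨fun hα => Filter.mem_of_superset h.1 (Iic_subset_Iic.2 hα), fun hα => h.2 hα⟩

theorem isClopen_mem (A : Set Omega1) : IsClopen {p : BoundedUltrafilter | A ∈ p.1} :=
  ⟨(ultrafilter_isClosed_basic A).preimage continuous_subtype_val,
    (ultrafilter_isOpen_basic A).preimage continuous_subtype_val⟩

theorem isClopen_height_le (α : Omega1) : IsClopen {p : BoundedUltrafilter | p.height ≤ α} := by
  simp only [height_le_iff]
  exact isClopen_mem _

theorem isCompact_height_le (α : Omega1) : IsCompact {p : BoundedUltrafilter | p.height ≤ α} := by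
  simp only [height_le_iff]
  refine Subtype.isCompact_iff.2 ?_
  convert (ultrafilter_isClosed_basic (Iic α)).isCompact using 1
  ext p
  exact ⟨by rintro ⟨q, hq, rfl⟩; exact hq, fun hp => ⟨⟨p, α, hp⟩, hp, rfl⟩⟩

theorem isOmegaBounded : IsOmegaBounded BoundedUltrafilter := fun A hA => by
  obtain ⟨α, hα⟩ := exists_upper_of_countable (hA.image height)
  exact (isCompact_height_le α).of_isClosed_subset isClosed_closure
    (closure_minimal (fun p hp => (hα _ ⟨p, hp, rfl⟩).le) (isClopen_height_le α).1)

theorem isLindelof_height_le (α : Omega1) :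
    IsLindelof {p : BoundedUltrafilter | p.height ≤ α} :=
  (isCompact_height_le α).isLindelof

theorem exists_le_height (α : Omega1) : ∃ p : BoundedUltrafilter, α ≤ p.height := by
  have h : Iic α ∈ (pure α : Ultrafilter Omega1) := Ultrafilter.mem_pure.2 (mem_Iic.2 le_rfl)
  let p : BoundedUltrafilter := ⟨pure α, α, h⟩
  have h' : Iic p.height ∈ (pure α : Ultrafilter Omega1) := height_le_iff.1 (le_refl p.height)
  exact ⟨p, mem_Iic.1 (Ultrafilter.mem_pure.1 h')⟩

/-- A sparse `ω₁`-sequence in `D` concentrates on pairwise disjoint intervals. The ultrafilters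
containing the union of the intervals with limit (or zero) index form a clopen set; the other
indices give unboundedly many points of `D` outside it. -/
theorem containsNoDirection : ContainsNoDirection BoundedUltrafilter := fun D hD => by
  have hb := @not_isBoundedSet_height _ _ _ isClopen_height_le isLindelof_height_le
  have hD' := hb.1 hD.1.2
  choose p hpD hp using fun α => hD' (Order.succ α)
  obtain ⟨b, hgb⟩ := Omega1.exists_overtaking fun α => (p α).height
  have hlt : ∀ α, α < (p α).height := fun α => (Order.lt_succ α).trans_le (hp α)
  have hbm : StrictMono b := fun η ξ h => (hlt _).trans (hgb η ξ h)
  -- `p (b ξ)` has height above `b ξ`, so it contains this interval, and the choice of `b` makes the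
  -- intervals disjoint.
  let I : Omega1 → Set Omega1 := fun ξ => Ioc (b ξ) (p (b ξ)).height
  have hI : ∀ ξ, I ξ ∈ (p (b ξ)).1 := fun ξ => by
    have h1 : Iic (p (b ξ)).height ∈ (p (b ξ)).1 := height_le_iff.1 le_rfl
    have h2 : (Iic (b ξ))ᶜ ∈ (p (b ξ)).1 := by
      rw [Ultrafilter.compl_mem_iff_notMem, ← height_le_iff]
      exact (hlt _).not_ge
    filter_upwards [h1, h2] with x hx hx'
    exact ⟨not_le.1 hx', hx⟩
  have hdisj : ∀ ξ η x, x ∈ I ξ → x ∈ I η → ξ = η := by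
    intro ξ η x h1 h2
    rcases lt_trichotomy ξ η with h | h | h
    · exact absurd (h2.1.trans_le h1.2) (hgb _ _ h).not_gt
    · exact h
    · exact absurd (h1.1.trans_le h2.2) (hgb _ _ h).not_gt
  have hsel : ∀ S : Set Omega1, (∀ α, ∃ ξ ∈ S, α ≤ ξ) → ∀ E : Set BoundedUltrafilter,
      (∀ ξ ∈ S, p (b ξ) ∈ E) → ¬ IsBoundedSet (D ∩ E) := fun S hS E hE => hb.2 fun α => by
    obtain ⟨ξ, hξ, hαξ⟩ := hS α
    exact ⟨p (b ξ), ⟨hpD _, hE ξ hξ⟩, hαξ.trans (hbm.le_apply.trans (hlt _).le)⟩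
  refine (isClopen_mem (⋃ ξ, ⋃ (_ : Order.IsSuccPrelimit ξ), I ξ)).not_isDirection
    (isCanonicalSeq_height isClopen_height_le isLindelof_height_le)
    (isSlicer_height isClopen_height_le) (D := D) ?_ ?_ hD
  · refine hsel {ξ | Order.IsSuccPrelimit ξ} (fun α => ?_) _ fun ξ hξ => ?_
    · obtain ⟨ξ, h1, h2⟩ := Omega1.exists_isSuccPrelimit α
      exact ⟨ξ, h2, h1.le⟩
    · exact Filter.mem_of_superset (hI ξ) (subset_iUnion₂_of_subset ξ hξ subset_rfl)
  · refine hsel {ξ | ¬ Order.IsSuccPrelimit ξ} (fun α => ?_) _ fun ξ hξ hmem => ?_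
    · exact ⟨_, Order.not_isSuccPrelimit_succ α, Order.le_succ α⟩
    · obtain ⟨x, hx, hx'⟩ := (p (b ξ)).1.neBot.nonempty_of_mem (Filter.inter_mem hmem (hI ξ))
      obtain ⟨η, hη, hxη⟩ := mem_iUnion₂.1 hx
      exact hξ (hdisj _ _ x hxη hx' ▸ hη)

end BoundedUltrafilter

/-! ### The space of part (a) -/

theorem exists_omegaBounded_sigmaSpace :
    ∃ (X : Type) (_ : TopologicalSpace X) (U : Omega1 → Set X) (s : X → LongRay),
      IsTypeI X ∧ IsCanonicalSeq U ∧ IsSlicer U s ∧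
      IsTypeI (SigmaSpace s) ∧ IsOmegaBounded (SigmaSpace s) ∧
      IsDirectionInItself (SigmaSpace s) ∧
      ∃ C : Set (SigmaSpace s), IsClubSubset C ∧ ContainsNoDirectionInItself C := by
  have hU := isCanonicalSeq_height BoundedUltrafilter.isClopen_height_le
    BoundedUltrafilter.isLindelof_height_le
  have hs := isSlicer_height BoundedUltrafilter.isClopen_height_le
  have hX := isTypeI_height BoundedUltrafilter.isClopen_height_le
    BoundedUltrafilter.isLindelof_height_le BoundedUltrafilter.exists_le_height
  have hω := BoundedUltrafilter.isOmegaBounded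
  have := hω.countablyCompactSpace
  exact ⟨BoundedUltrafilter, inferInstance, _, _, hX, hU, hs, SigmaSpace.isTypeI hU hs,
    SigmaSpace.isOmegaBounded hU hs hω,
    SigmaSpace.isDirectionInItself hU hs (CountablyCompactSpace.homotopyRigid _),
    SigmaSpace.exists_containsNoDirectionInItself hX hU hs BoundedUltrafilter.containsNoDirection⟩

/-! ### Slicers of locally compact Type I spaces -/

section Slicer

variable {X : Type*} [TopologicalSpace X] {U : Omega1 → Set X}

/-- Replacing the members at limits and at zero by the union of the earlier ones suffices: closures
still fit, because `closure (U α) ⊆ U (α + 1)` and `α + 1` is below any limit above `α`. -/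
theorem IsTypeISeq.exists_isCanonicalSeq (hU : IsTypeISeq U) :
    ∃ V : Omega1 → Set X, IsCanonicalSeq V := by
  classical
  let V : Omega1 → Set X := fun α =>
    if Order.IsSuccPrelimit α then ⋃ β, ⋃ (_ : β < α), U β else U α
  have hVU : ∀ α, V α ⊆ U α := fun α => by
    by_cases h : Order.IsSuccPrelimit α
    · simp only [V, if_pos h]
      exact iUnion₂_subset fun β hβ => hU.mono hβ.le
    · simp only [V, if_neg h, subset_rfl]
  have hUV : ∀ α β, α < β → closure (U α) ⊆ V β := fun α β hαβ => by
    by_cases h : Order.IsSuccPrelimit β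
    · simp only [V, if_pos h]
      exact (hU.closure_subset _ _ (Order.lt_succ α)).trans
        (subset_iUnion₂_of_subset _ (h.succ_lt hαβ) subset_rfl)
    · simp only [V, if_neg h]
      exact hU.closure_subset _ _ hαβ
  refine ⟨V, ⟨⟨eq_univ_of_forall fun x => ?_, fun α => ?_, fun α => ?_, fun α β h => ?_⟩,
    fun α hα => ?_⟩⟩
  · obtain ⟨α, hα⟩ := hU.exists_mem x
    exact mem_iUnion.2 ⟨_, hUV α _ (Order.lt_succ α) (subset_closure hα)⟩
  · by_cases h : Order.IsSuccPrelimit α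
    · simp only [V, if_pos h]
      exact isOpen_biUnion fun β _ => hU.isOpen β
    · simp only [V, if_neg h]
      exact hU.isOpen α
  · exact (hU.isLindelof_closure α).of_isClosed_subset isClosed_closure (closure_mono (hVU α))
  · exact (closure_mono (hVU α)).trans (hUV α β h)
  · refine subset_antisymm ?_ (iUnion₂_subset fun β hβ =>
      (hVU β).trans (subset_closure.trans (hUV β α hβ)))
    conv_lhs => simp only [V, if_pos hα]
    refine iUnion₂_subset fun β hβ => ?_
    exact (subset_closure.trans (hUV β _ (Order.lt_succ β))).trans
      (subset_iUnion₂_of_subset _ (hα.succ_lt hβ) subset_rfl)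

theorem IsTypeISeq.weaklyLocallyCompactSpace (hU : IsTypeISeq U)
    (hK : ∀ α, IsCompact (closure (U α))) : WeaklyLocallyCompactSpace X := ⟨fun x => by
  obtain ⟨α, hα⟩ := hU.exists_mem x
  exact ⟨_, hK α, Filter.mem_of_superset ((hU.isOpen α).mem_nhds hα) subset_closure⟩⟩

namespace LongRay

open Classical in
/-- The map of `[0, 1]` onto the interval `[α, α + 1]` of the long ray. -/
noncomputable def path (α : Omega1) (r : unitInterval) : LongRay :=
  if h : (r : ℝ) < 1 then mk α ⟨r, r.2.1, h⟩ else ofOmega1 (Order.succ α)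

theorem ofOmega1_le_path (α : Omega1) (r : unitInterval) : ofOmega1 α ≤ path α r := by
  unfold path
  split_ifs
  · exact ofOmega1_le.2 le_rfl
  · exact ofOmega1_le_ofOmega1.2 (Order.le_succ α)

theorem path_le_ofOmega1_succ (α : Omega1) (r : unitInterval) :
    path α r ≤ ofOmega1 (Order.succ α) := by
  unfold path
  split_ifs
  · exact (lt_ofOmega1.2 (Order.lt_succ α)).le
  · exact le_rfl

theorem lt_path_iff (a : LongRay) (r : unitInterval) : a < path a.idx r ↔ (a.frac : ℝ) < r := by
  unfold path
  split_ifs with h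
  · rw [lt_iff]
    simp [← Subtype.coe_lt_coe]
  · exact iff_of_true a.lt_ofOmega1_succ (a.frac.2.2.trans_le (not_lt.1 h))

theorem path_lt_iff (a : LongRay) (r : unitInterval) : path a.idx r < a ↔ (r : ℝ) < a.frac := by
  unfold path
  split_ifs with h
  · rw [lt_iff]
    simp [← Subtype.coe_lt_coe]
  · exact iff_of_false a.lt_ofOmega1_succ.not_gt
      (a.frac.2.2.trans_le (not_lt.1 h)).not_gt

theorem exists_between_frac_pos {x y : LongRay} (h : x < y) :
    ∃ b, x < b ∧ b < y ∧ 0 < (b.frac : ℝ) := by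
  obtain ⟨r, -, h1, h2⟩ := exists_rat_between h
  refine ⟨_, h1, h2, ?_⟩
  rcases lt_iff.1 h1 with h | h
  · exact absurd h (lt_irrefl _)
  · exact x.frac.2.1.trans_lt h.2

end LongRay

/-- Each slice is sent into its unit interval of the ray by its own function. Since the other
functions are constant 0 or 1 there, comparing `s x` with a point `a` involves only the function of
index `a.idx`. -/
theorem IsCanonicalSeq.exists_isSlicer (hU : IsCanonicalSeq U) (g : Omega1 → X → unitInterval)
    (hg : ∀ α, Continuous (g α)) (hg0 : ∀ α, ∀ x ∈ U α, g α x = 0)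
    (hg1 : ∀ α, ∀ x ∉ U (Order.succ α), g α x = 1) : ∃ s : X → LongRay, IsSlicer U s := by
  choose β hβ hβ' using hU.exists_mem_diff
  let s : X → LongRay := fun x => LongRay.path (β x) (g (β x) x)
  have hmono := hU.isTypeISeq.mono
  have hlt : ∀ α x, β x < α → g α x = 0 := fun α x h =>
    hg0 α x (hmono (Order.succ_le_of_lt h) (hβ x))
  have hgt : ∀ α x, α < β x → g α x = 1 := fun α x h =>
    hg1 α x fun hx => hβ' x (hmono (Order.succ_le_of_lt h) hx)
  have key : ∀ a x, a < s x ↔ (a.frac : ℝ) < g a.idx x := by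
    intro a x
    rcases lt_trichotomy a.idx (β x) with h | h | h
    · rw [hgt _ _ h]
      refine iff_of_true ?_ a.frac.2.2
      exact (LongRay.lt_ofOmega1.2 h).trans_le (LongRay.ofOmega1_le_path _ _)
    · simp only [s, ← h]
      exact LongRay.lt_path_iff a _
    · rw [hlt _ _ h]
      refine iff_of_false (not_lt.2 ?_) (not_lt.2 a.frac.2.1)
      exact (LongRay.path_le_ofOmega1_succ _ _).trans
        (LongRay.ofOmega1_le.2 (Order.succ_le_of_lt h))
  -- The equivalence can fail when `a.frac = 0`: no value of `g` is below 0. Upper bounds are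
  -- therefore tested at points with positive second coordinate.
  have key' : ∀ a x, 0 < (a.frac : ℝ) → (s x < a ↔ (g a.idx x : ℝ) < a.frac) := by
    intro a x ha
    rcases lt_trichotomy a.idx (β x) with h | h | h
    · rw [hgt _ _ h]
      refine iff_of_false (not_lt.2 ?_) (not_lt.2 a.frac.2.2.le)
      exact (LongRay.lt_ofOmega1.2 h).le.trans (LongRay.ofOmega1_le_path _ _)
    · simp only [s, ← h]
      exact LongRay.path_lt_iff a _
    · rw [hlt _ _ h]
      refine iff_of_true ?_ ha
      refine ((LongRay.path_le_ofOmega1_succ _ _).trans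
        (LongRay.ofOmega1_le_ofOmega1.2 (Order.succ_le_of_lt h))).trans_lt ?_
      exact LongRay.lt_iff.2 (Or.inr ⟨rfl, ha⟩)
  have hs : Continuous s := by
    refine OrderTopology.continuous_iff.2 fun a => ⟨?_, ?_⟩
    · have : s ⁻¹' Ioi a = {x | (a.frac : ℝ) < g a.idx x} := by
        ext x
        exact key a x
      rw [this]
      exact isOpen_lt continuous_const (continuous_subtype_val.comp (hg _))
    · have : s ⁻¹' Iio a = ⋃ b, ⋃ (_ : b < a ∧ 0 < (b.frac : ℝ)),
          {x | (g b.idx x : ℝ) < b.frac} := by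
        ext x
        simp only [mem_preimage, mem_Iio, mem_iUnion, exists_prop]
        refine ⟨fun hx => ?_, fun ⟨b, ⟨hba, hb⟩, hx⟩ => ((key' b x hb).2 hx).trans hba⟩
        obtain ⟨b, h1, h2, h3⟩ := LongRay.exists_between_frac_pos hx
        exact ⟨b, ⟨h2, h3⟩, (key' b x h3).1 h1⟩
      rw [this]
      exact isOpen_biUnion fun b _ =>
        isOpen_lt (continuous_subtype_val.comp (hg _)) continuous_const
  refine ⟨s, hs, fun α x ⟨hx, hx'⟩ => ⟨?_, ?_⟩⟩
  · by_contra! hcon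
    obtain ⟨b, h1, h2, h3⟩ := LongRay.exists_between_frac_pos hcon
    have h4 := (key' b x h3).1 h1
    rw [hg1 _ _ fun h => hx' (hmono (Order.succ_le_of_lt (LongRay.lt_ofOmega1.1 h2)) h)] at h4
    exact h4.not_gt b.frac.2.2
  · refine closure_minimal (t := s ⁻¹' Iic (LongRay.ofOmega1 (Order.succ α))) (fun y hy => ?_)
      (isClosed_Iic.preimage hs) hx
    change s y ≤ LongRay.ofOmega1 (Order.succ α)
    by_contra! h
    have h4 := (key _ y).1 h
    rw [LongRay.idx_ofOmega1, hg0 _ _ hy] at h4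
    exact lt_irrefl _ h4

theorem IsCanonicalSeq.exists_isSlicer_of_isCompact [T2Space X] (hU : IsCanonicalSeq U)
    (hK : ∀ α, IsCompact (closure (U α))) : ∃ s : X → LongRay, IsSlicer U s := by
  have := hU.isTypeISeq.weaklyLocallyCompactSpace hK
  have hex : ∀ α, ∃ g : X → unitInterval, Continuous g ∧ (∀ x ∈ U α, g x = 0) ∧
      ∀ x ∉ U (Order.succ α), g x = 1 := fun α => by
    obtain ⟨f, hf1, hf0, -, hf⟩ := exists_continuous_one_zero_of_isCompact (hK α)
      (hU.isTypeISeq.isOpen (Order.succ α)).isClosed_compl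
      (disjoint_compl_right_iff_subset.2 (hU.isTypeISeq.closure_subset _ _ (Order.lt_succ α)))
    refine ⟨fun x => unitInterval.symm ⟨f x, hf x⟩, by fun_prop, fun x hx => ?_, fun x hx => ?_⟩
    · have : f x = 1 := hf1 (subset_closure hx)
      ext; simp [this]
    · have : f x = 0 := hf0 hx
      ext; simp [this]
  choose g hg hg0 hg1 using hex
  exact hU.exists_isSlicer g hg hg0 hg1

/-- Lindelöf subspaces of locally planar spaces are second countable. -/
theorem IsSurface.secondCountableTopology (hX : IsSurface X) {A : Set X}
    (hA : IsLindelof (closure A)) : SecondCountableTopology A := by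
  choose V hV hxV e using hX.locally_plane
  obtain ⟨t, ht, -, hcov⟩ := hA.elim_nhds_subcover V fun x _ => (hV x).mem_nhds (hxV x)
  have := ht.to_subtype
  have h2 : ∀ x, SecondCountableTopology (V x) := fun x =>
    (e x).some.isEmbedding.secondCountableTopology
  have h3 : ∀ i : t, SecondCountableTopology (Subtype.val ⁻¹' V i : Set A) := fun i => by
    let j : (Subtype.val ⁻¹' V i : Set A) → V i := fun a => ⟨a.1.1, a.2⟩
    have hj : IsEmbedding j := by
      refine IsEmbedding.of_comp (by fun_prop) continuous_subtype_val ?_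
      exact (IsEmbedding.subtypeVal (p := (· ∈ A))).comp
        (IsEmbedding.subtypeVal (p := (· ∈ (Subtype.val ⁻¹' V i : Set A))))
    exact hj.secondCountableTopology
  refine TopologicalSpace.secondCountableTopology_of_countable_cover
    (U := fun i : t => (Subtype.val ⁻¹' V i : Set A))
    (fun i => (hV i).preimage continuous_subtype_val) (eq_univ_of_forall fun a => ?_)
  obtain ⟨x, hx, hax⟩ := mem_iUnion₂.1 (hcov (subset_closure a.2))
  exact mem_iUnion.2 ⟨⟨x, hx⟩, hax⟩

end Slicer

/-! ### The space of part (c) -/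

theorem exists_sigmaSpace_of_surface {N : Type} [TopologicalSpace N] (hN : IsSurface N)
    (hI : IsTypeI N) (hω : IsOmegaBounded N) (hdir : ContainsNoDirection N) :
    ∃ (X : Type) (_ : TopologicalSpace X) (U : Omega1 → Set X) (s : X → LongRay),
      IsTypeI X ∧ IsCanonicalSeq U ∧ IsSlicer U s ∧
      IsTypeI (SigmaSpace s) ∧ IsLocallyMetrizable (SigmaSpace s) ∧
      IsLocallySeparable (SigmaSpace s) ∧ IsOmega1Compact (SigmaSpace s) ∧
      IsOmegaBounded (SigmaSpace s) ∧
      IsDirectionInItself (SigmaSpace s) ∧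
      ∃ C : Set (SigmaSpace s), IsClubSubset C ∧ ContainsNoDirectionInItself C := by
  obtain ⟨U₀, hU₀⟩ := hI.exists_seq
  obtain ⟨U, hU⟩ := hU₀.exists_isCanonicalSeq
  have := hN.t2
  have hL := hU.isTypeISeq.isLindelof_closure
  have hK : ∀ α, IsCompact (closure (U α)) := fun α =>
    hω.isCompact_of_isLindelof (hL α) isClosed_closure
  obtain ⟨s, hs⟩ := hU.exists_isSlicer_of_isCompact hK
  have := hU.isTypeISeq.weaklyLocallyCompactSpace hK
  have := hω.countablyCompactSpace
  have h2 : ∀ α, SecondCountableTopology (U α) := fun α => hN.secondCountableTopology (hL α)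
  have hSω := SigmaSpace.isOmegaBounded hU hs hω
  exact ⟨N, inferInstance, U, s, hI, hU, hs, SigmaSpace.isTypeI hU hs,
    SigmaSpace.isLocallyMetrizable hU hs h2, SigmaSpace.isLocallySeparable hU hs h2,
    hSω.isOmega1Compact, hSω,
    SigmaSpace.isDirectionInItself hU hs (CountablyCompactSpace.homotopyRigid _),
    SigmaSpace.exists_containsNoDirectionInItself hI hU hs hdir⟩

/-! ### Suslin trees with the tree topology -/

/-- A Hausdorff, well pruned Suslin tree with height function `h` and the tree topology. -/
structure IsPrunedSuslinTree {X : Type*} [PartialOrder X] [TopologicalSpace X] (h : X → Omega1) :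
    Prop where
  nonempty : Nonempty X
  total_below : ∀ p q r : X, p ≤ r → q ≤ r → p ≤ q ∨ q ≤ p
  strictMono : StrictMono h
  exists_le : ∀ p, ∀ β ≤ h p, ∃ q ≤ p, h q = β
  exists_ge : ∀ p, ∀ β, h p ≤ β → ∃ q, p ≤ q ∧ h q = β
  eq_of_limit : ∀ p q, Order.IsSuccPrelimit (h p) → h p = h q → (∀ r < p, r < q) → p = q
  antichain_countable : ∀ A : Set X, IsAntichain (· ≤ ·) A → A.Countable
  chain_countable : ∀ C : Set X, IsChain (· ≤ ·) C → C.Countable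
  isOpen_iff : ∀ G : Set X, IsOpen G ↔
    ∀ p ∈ G, (∃ β, β < h p) → ∃ β < h p, ∀ q ≤ p, β < h q → q ∈ G

namespace IsPrunedSuslinTree

variable {X : Type*} [PartialOrder X] [TopologicalSpace X] {h : X → Omega1}

section Order

variable (hT : IsPrunedSuslinTree h)
include hT

theorem le_of_height_le {p q r : X} (hp : p ≤ r) (hq : q ≤ r) (hpq : h p ≤ h q) : p ≤ q := by
  rcases hT.total_below p q r hp hq with h1 | h1
  · exact h1
  · rcases h1.lt_or_eq with h2 | h2
    · exact absurd (hT.strictMono h2) hpq.not_gt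
    · exact h2.ge

theorem countable_level (α : Omega1) : {x | h x = α}.Countable := by
  refine hT.antichain_countable _ fun p (hp : h p = α) q (hq : h q = α) hne hle => ?_
  exact ((hp.trans hq.symm).not_lt (hT.strictMono (hle.lt_of_ne hne))).elim

theorem countable_height_le (α : Omega1) : {x | h x ≤ α}.Countable := by
  refine ((Omega1.countable_Iic α).biUnion fun β _ => hT.countable_level β).mono fun x hx => ?_
  exact mem_iUnion₂.2 ⟨h x, hx, rfl⟩

/-- An upwards closed set contains all high enough nodes below which it is dense. -/
theorem exists_forall_mem {D : Set X} (hD : ∀ y ∈ D, ∀ z, y ≤ z → z ∈ D) :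
    ∃ α, ∀ y, α ≤ h y → (∃ z ∈ D, y ≤ z) → y ∈ D := by
  -- The minimal nodes of `D` form an antichain, so their heights are bounded by some `α`. The
  -- minimal node of `D` below `z` is then low enough to lie below `y`.
  let A : Set X := {a ∈ D | ∀ b ∈ D, b ≤ a → b = a}
  have hA : A.Countable := hT.antichain_countable A fun a ha b hb hne hle => hne (hb.2 a ha.1 hle)
  obtain ⟨α, hα⟩ := exists_upper_of_countable (hA.image h)
  refine ⟨α, fun y hy ⟨z, hz, hyz⟩ => ?_⟩
  obtain ⟨β, ⟨a, ⟨ha, haz⟩, rfl⟩, hmin⟩ := Omega1.exists_isLeast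
    (S := h '' {b | b ∈ D ∧ b ≤ z}) ⟨h z, z, ⟨hz, le_rfl⟩, rfl⟩
  have haA : a ∈ A := ⟨ha, fun b hb hba => by
    by_contra hne
    exact (hT.strictMono (hba.lt_of_ne hne)).not_ge (hmin ⟨b, ⟨hb, hba.trans haz⟩, rfl⟩)⟩
  exact hD a ha y (hT.le_of_height_le haz hyz ((hα _ ⟨a, haA, rfl⟩).le.trans hy))

/-- An unbounded set is dense above some node. -/
theorem exists_dense_above {A : Set X} (hA : ∀ α, ∃ z ∈ A, α ≤ h z) :
    ∃ x, ∀ y, x ≤ y → ∃ z ∈ A, y ≤ z := by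
  by_contra! hcon
  -- If nodes without extension in `A` existed above every node, all high nodes would be of this
  -- kind, including some node of `A`.
  obtain ⟨α, hα⟩ := hT.exists_forall_mem (D := {y | ∀ z ∈ A, ¬ y ≤ z})
    fun y hy z hyz w hw hzw => hy w hw (hyz.trans hzw)
  obtain ⟨a, ha, hαa⟩ := hA α
  obtain ⟨y, hy, hyA⟩ := hcon a
  exact hα a hαa ⟨y, hyA, hy⟩ a ha le_rfl

end Order

theorem isClosed_mem (hT : IsPrunedSuslinTree h) {F : Set X} (hF : IsClosed F) {y : X}
    (hy : ∃ β, β < h y) (hlim : ∀ β < h y, ∃ z ∈ F, z ≤ y ∧ β < h z) : y ∈ F := by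
  by_contra hyF
  obtain ⟨β, hβ, hsub⟩ := (hT.isOpen_iff Fᶜ).1 hF.isOpen_compl y hyF hy
  obtain ⟨z, hz, hzy, hβz⟩ := hlim β hβ
  exact hsub z hzy hβz hz

/-- Countably many closed sets which are dense above a node all contain some level above it. -/
theorem exists_level_subset (hT : IsPrunedSuslinTree h) {ι : Type*} [Countable ι] {F : ι → Set X}
    (hF : ∀ i, IsClosed (F i)) {x : X} (hd : ∀ i y, x ≤ y → ∃ z ∈ F i, y ≤ z) :
    ∃ α, h x ≤ α ∧ ∀ y, x ≤ y → h y = α → (∃ β, β < h y) ∧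
      ∀ i, y ∈ F i ∧ ∀ β < h y, ∃ z ∈ F i, z < y ∧ β < h z := by
  have h1 : ∀ (i : ι) (β : Omega1), ∃ α, ∀ y, x ≤ y → α ≤ h y →
      ∃ z ∈ F i, z ≤ y ∧ β < h z := fun i β => by
    obtain ⟨α, hα⟩ := hT.exists_forall_mem (D := {y | x ≤ y ∧ ∃ z ∈ F i, z ≤ y ∧ β < h z})
      fun y ⟨hy, z, hz, hzy, hβ⟩ w hw => ⟨hy.trans hw, z, hz, hzy.trans hw, hβ⟩
    refine ⟨α, fun y hxy hy => (hα y hy ?_).2⟩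
    obtain ⟨y', hyy', hy'⟩ := hT.exists_ge y (max (h y) (Order.succ β)) (le_max_left _ _)
    obtain ⟨z, hz, hyz⟩ := hd i y' (hxy.trans hyy')
    refine ⟨z, ⟨(hxy.trans hyy').trans hyz, z, hz, le_rfl, ?_⟩, hyy'.trans hyz⟩
    refine ((Order.lt_succ β).trans_le (le_max_right (h y) _)).trans_le ?_
    rw [← hy']
    exact hT.strictMono.monotone hyz
  choose a ha using h1
  choose δ hδ using fun β => Omega1.exists_upper fun i => a i β
  -- For `β < α`, a predecessor of `y` below level `α` already has a point of `F i` of height above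
  -- `β` under it. So the points of `F i` strictly below `y` converge to `y`.
  obtain ⟨α, hxα, hα⟩ := Omega1.exists_closed_under (fun β => max (δ β) (h x)) (h x)
  have key : ∀ y, x ≤ y → h y = α → ∀ i, ∀ β < h y, ∃ z ∈ F i, z < y ∧ β < h z := by
    intro y hxy hy i β hβ
    have hlt := hα β (hy ▸ hβ)
    obtain ⟨q, hqy, hq⟩ := hT.exists_le y (max (δ β) (h x)) (hy ▸ hlt.le)
    have hxq : x ≤ q := hT.le_of_height_le hxy hqy (hq ▸ le_max_right _ _)
    obtain ⟨z, hz, hzq, hβz⟩ := ha i β q hxq (hq ▸ (hδ β i).le.trans (le_max_left _ _))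
    refine ⟨z, hz, hzq.trans_lt (hqy.lt_of_ne ?_), hβz⟩
    rintro rfl
    exact hlt.ne (hq.symm.trans hy)
  refine ⟨α, hxα.le, fun y hxy hy => ⟨⟨h x, hy ▸ hxα⟩, fun i => ⟨?_, key y hxy hy i⟩⟩⟩
  refine hT.isClosed_mem (hF i) ⟨h x, hy ▸ hxα⟩ fun β hβ => ?_
  obtain ⟨z, hz, hzy, hβz⟩ := key y hxy hy i β hβ
  exact ⟨z, hz, hzy.le, hβz⟩

/-! #### Topology -/

section Topology

variable (hT : IsPrunedSuslinTree h)
include hT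

theorem isClopen_height_le (α : Omega1) : IsClopen {x | h x ≤ α} := by
  refine ⟨isOpen_compl_iff.1 ((hT.isOpen_iff _).2 fun p hp _ => ?_),
    (hT.isOpen_iff _).2 fun p hp ⟨β, hβ⟩ => ⟨β, hβ, fun q hq _ => ?_⟩⟩
  · exact ⟨α, not_le.1 hp, fun q _ hq => not_le.2 hq⟩
  · exact (hT.strictMono.monotone hq).trans hp

theorem isLindelof_height_le (α : Omega1) : IsLindelof {x | h x ≤ α} :=
  (hT.countable_height_le α).isLindelof

theorem isOpen_Iic (p : X) : IsOpen (Iic p) :=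
  (hT.isOpen_iff _).2 fun _ hx ⟨β, hβ⟩ => ⟨β, hβ, fun _ hq _ => le_trans hq hx⟩

theorem isOpen_segment (p : X) (β : Omega1) : IsOpen {q | q ≤ p ∧ β < h q} := by
  have : {q | q ≤ p ∧ β < h q} = Iic p ∩ {q | h q ≤ β}ᶜ := by
    ext q
    simp
  rw [this]
  exact (hT.isOpen_Iic p).inter (hT.isClopen_height_le β).compl.2

/-- If `x` has height `γ + 1`, all nodes of height above `γ` below an extension of `x` are
themselves extensions of `x`; hence the cone is open. -/
theorem isClopen_Ici {x : X} (hx : ¬ Order.IsSuccPrelimit (h x)) : IsClopen (Ici x) := by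
  obtain ⟨γ, hγ⟩ := Omega1.exists_eq_succ_of_not_isSuccPrelimit hx
  refine ⟨isOpen_compl_iff.1 ((hT.isOpen_iff _).2 fun p hp ⟨β, hβ⟩ => ?_),
    (hT.isOpen_iff _).2 fun p hp _ => ⟨γ, ?_, fun q hq hγq => ?_⟩⟩
  · exact ⟨β, hβ, fun q hq _ hxq => hp (le_trans hxq hq)⟩
  · exact (hγ ▸ Order.lt_succ γ).trans_le (hT.strictMono.monotone hp)
  · exact hT.le_of_height_le hp hq (hγ ▸ Order.succ_le_of_lt hγq)

theorem isClosed_segment (p : X) (β : Omega1) : IsClosed {q | q ≤ p ∧ β < h q} := by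
  refine isOpen_compl_iff.1 (isOpen_iff_forall_mem_open.2 fun x hx => ?_)
  by_cases hxβ : h x ≤ β
  · exact ⟨_, fun q hq hq' => (not_lt.2 hq) hq'.2, (hT.isClopen_height_le β).2, hxβ⟩
  have hxp : ¬ x ≤ p := fun hxp => hx ⟨hxp, not_le.1 hxβ⟩
  by_cases hlim : Order.IsSuccPrelimit (h x)
  · by_cases hhp : h p < h x
    · refine ⟨_, fun q hq hq' => ?_, (hT.isClopen_height_le (h p)).compl.2, not_le.2 hhp⟩
      exact hq (hT.strictMono.monotone hq'.1)
    · obtain ⟨p', hp'p, hp'⟩ := hT.exists_le p (h x) (not_lt.1 hhp)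
      -- Here the Hausdorff condition is used: at a limit level, `x` would otherwise coincide with
      -- the predecessor `p'` of `p`.
      have : ∃ r < x, ¬ r ≤ p := by
        by_contra! hcon
        refine hxp ((hT.eq_of_limit x p' hlim hp'.symm fun r hr => ?_).le.trans hp'p)
        have hlt : h r < h p' := hp' ▸ hT.strictMono hr
        refine (hT.le_of_height_le (hcon r hr) hp'p hlt.le).lt_of_ne ?_
        rintro rfl
        exact hlt.false
      obtain ⟨r, hrx, hrp⟩ := this
      refine ⟨_, fun q hq hq' => ?_, hT.isOpen_segment x (h r), le_rfl, hT.strictMono hrx⟩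
      exact hrp ((hT.le_of_height_le hrx.le hq.1 hq.2.le).trans hq'.1)
  · obtain ⟨γ, hγ⟩ := Omega1.exists_eq_succ_of_not_isSuccPrelimit hlim
    refine ⟨_, fun q hq hq' => ?_, hT.isOpen_segment x γ, le_rfl, hγ ▸ Order.lt_succ γ⟩
    exact hxp ((hT.le_of_height_le le_rfl hq.1 (hγ ▸ Order.succ_le_of_lt hq.2)).trans hq'.1)

theorem segment_mem_nhds {p : X} {G : Set X} (hG : G ∈ 𝓝 p) (hp : ∃ β, β < h p) :
    ∃ β < h p, {q | q ≤ p ∧ β < h q} ⊆ G := by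
  obtain ⟨G', hG'G, hG', hpG⟩ := mem_nhds_iff.1 hG
  obtain ⟨β, hβ, hsub⟩ := (hT.isOpen_iff G').1 hG' p hpG hp
  exact ⟨β, hβ, fun q hq => hG'G (hsub q hq.1 hq.2)⟩

theorem singleton_mem_nhds {p : X} (hp : ¬ ∃ β, β < h p) : {p} ∈ 𝓝 p :=
  ((hT.isOpen_iff _).2 fun q hq hβ => absurd hβ (by rwa [mem_singleton_iff.1 hq])).mem_nhds rfl

theorem t1Space : T1Space X := by
  refine ⟨fun p => isOpen_compl_iff.1 ((hT.isOpen_iff _).2 fun x hx ⟨β, hβ⟩ => ?_)⟩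
  by_cases hpx : p ≤ x
  · refine ⟨h p, hT.strictMono (hpx.lt_of_ne fun h => hx h.symm), fun q _ hq hqp => ?_⟩
    exact hq.ne (congrArg h (mem_singleton_iff.1 hqp).symm)
  · exact ⟨β, hβ, fun q hq _ hqp => hpx (mem_singleton_iff.1 hqp ▸ hq)⟩

theorem t3Space : T3Space X := by
  have := hT.t1Space
  have : RegularSpace X := by
    refine .of_exists_mem_nhds_isClosed_subset fun p G hG => ?_
    by_cases hp : ∃ β, β < h p
    · obtain ⟨β, hβ, hsub⟩ := hT.segment_mem_nhds hG hp
      exact ⟨_, (hT.isOpen_segment p β).mem_nhds ⟨le_rfl, hβ⟩, hT.isClosed_segment p β, hsub⟩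
    · exact ⟨{p}, hT.singleton_mem_nhds hp, isClosed_singleton,
        singleton_subset_iff.2 (mem_of_mem_nhds hG)⟩
  exact { }

theorem firstCountableTopology : FirstCountableTopology X := by
  refine ⟨fun p => ?_⟩
  by_cases hp : ∃ β, β < h p
  · have hb : (𝓝 p).HasBasis (fun β => β < h p) fun β => {q | q ≤ p ∧ β < h q} :=
      ⟨fun G => ⟨fun hG => hT.segment_mem_nhds hG hp, fun ⟨β, hβ, hsub⟩ =>
        Filter.mem_of_superset ((hT.isOpen_segment p β).mem_nhds ⟨le_rfl, hβ⟩) hsub⟩⟩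
    exact Filter.HasCountableBasis.isCountablyGenerated ⟨hb, Omega1.countable_Iio (h p)⟩
  · have : 𝓝 p = pure p := le_antisymm
      (Filter.le_pure_iff.2 (hT.singleton_mem_nhds hp)) (pure_le_nhds p)
    rw [this]
    infer_instance

theorem secondCountableTopology (α : Omega1) : SecondCountableTopology {x | h x < α} := by
  have := hT.firstCountableTopology
  have : Countable {x | h x < α} :=
    ((hT.countable_height_le α).mono fun x (hx : h x < α) => hx.le).to_subtype
  infer_instance

theorem exists_le_height (α : Omega1) : ∃ x, α ≤ h x := by
  obtain ⟨p⟩ := hT.nonempty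
  obtain ⟨q, -, hq⟩ := hT.exists_ge p (max (h p) α) (le_max_left _ _)
  exact ⟨q, hq ▸ le_max_right _ _⟩

/-- Otherwise the cone above `x` would be a chain reaching every height, hence uncountable. -/
theorem exists_incomparable (x : X) : ∃ y z, x ≤ y ∧ x ≤ z ∧ ¬ y ≤ z ∧ ¬ z ≤ y := by
  by_contra! hcon
  have hc := hT.chain_countable (Ici x) fun y hy z hz _ => by
    by_cases hyz : y ≤ z
    · exact Or.inl hyz
    · exact Or.inr (hcon y z hy hz hyz)
  obtain ⟨β, hβ⟩ := exists_upper_of_countable (hc.image h)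
  obtain ⟨y, hxy, hy⟩ := hT.exists_ge x (max (h x) β) (le_max_left _ _)
  exact ((hβ _ ⟨y, hxy, rfl⟩).trans_le (hy ▸ le_max_right (h x) β)).false

/-- A club `D` is dense above some `x`, so it is unbounded in the disjoint cones of two incomparable
extensions. Passing to a successor height makes one cone clopen. -/
theorem containsNoDirection : ContainsNoDirection X := fun D hD => by
  have hb := @not_isBoundedSet_height X _ h hT.isClopen_height_le hT.isLindelof_height_le
  obtain ⟨x, hx⟩ := hT.exists_dense_above (hb.1 hD.1.2)
  obtain ⟨y, z, hxy, hxz, hyz, hzy⟩ := hT.exists_incomparable x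
  obtain ⟨y', hyy', hy'⟩ := hT.exists_ge y _ (Order.le_succ (h y))
  have hcone : ∀ w, x ≤ w → ∀ E : Set X, (∀ v, w ≤ v → v ∈ E) → ¬ IsBoundedSet (D ∩ E) :=
    fun w hw E hE => hb.2 fun α => by
      obtain ⟨v, hwv, hv⟩ := hT.exists_ge w (max (h w) α) (le_max_left _ _)
      obtain ⟨u, hu, hvu⟩ := hx v (hw.trans hwv)
      exact ⟨u, ⟨hu, hE u (hwv.trans hvu)⟩,
        ((le_max_right _ _).trans hv.ge).trans (hT.strictMono.monotone hvu)⟩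
  refine (hT.isClopen_Ici (x := y') ?_).not_isDirection
    (isCanonicalSeq_height hT.isClopen_height_le hT.isLindelof_height_le)
    (isSlicer_height hT.isClopen_height_le) (D := D)
    (hcone y' (hxy.trans hyy') _ fun v hv => hv) (hcone z hxz _ fun v hv hv' => ?_) hD
  · rw [hy']
    exact Order.not_isSuccPrelimit_succ _
  · rcases hT.total_below y z v (hyy'.trans hv') hv with h1 | h1
    · exact hyz h1
    · exact hzy h1

end Topology

/-! #### Rigidity of homotopies -/

/-- A continuous function to the long ray which is unbounded on every cone above `y` is proper
on the cone above `y`. -/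
theorem exists_forall_le_of_unbounded (hT : IsPrunedSuslinTree h) {f : X → LongRay}
    (hf : Continuous f) {y : X} (hub : ∀ z, y ≤ z → ∀ c, ∃ w, z ≤ w ∧ c < f w) (c : LongRay) :
    ∃ δ, ∀ z, y ≤ z → δ ≤ h z → c ≤ f z := by
  obtain ⟨δ, hδ⟩ := hT.exists_forall_mem (D := {z | y ≤ z ∧ ∀ w, z ≤ w → c ≤ f w})
    fun z hz w hzw => ⟨hz.1.trans hzw, fun v hv => hz.2 v (hzw.trans hv)⟩
  refine ⟨δ, fun z hyz hz => (hδ z hz ?_).2 z le_rfl⟩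
  by_contra! hcon
  obtain ⟨d, hd⟩ := exists_gt c
  have hd' : ∀ w, z ≤ w → ∃ v, w ≤ v ∧ f v < c := fun w hw => by
    by_contra! hw'
    exact hcon w ⟨hyz.trans hw, hw'⟩ hw
  -- Above `z`, both closed sets `f ≤ c` and `f ≥ d` are dense, so they share a level, although `c <
  -- d`.
  obtain ⟨α, hα, hlev⟩ := hT.exists_level_subset
    (F := fun b : Bool => cond b (f ⁻¹' Iic c) (f ⁻¹' Ici d)) (x := z)
    (by rintro (_ | _)
        · exact isClosed_Ici.preimage hf
        · exact isClosed_Iic.preimage hf)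
    (by rintro (_ | _) w hw
        · obtain ⟨v, hv, hv'⟩ := hub w (hyz.trans hw) d
          exact ⟨v, hv'.le, hv⟩
        · obtain ⟨v, hv, hv'⟩ := hd' w hw
          exact ⟨v, hv'.le, hv⟩)
  obtain ⟨v, hzv, hv⟩ := hT.exists_ge z α hα
  have h1 : f v ≤ c := ((hlev v hzv hv).2 true).1
  have h2 : d ≤ f v := ((hlev v hzv hv).2 false).1
  exact (hd.trans_le (h2.trans h1)).false

/-- Above a high enough level, each cone decides whether a homotopy is bounded or proper. -/
theorem exists_decide (hT : IsPrunedSuslinTree h) {f : X × unitInterval → LongRay}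
    (hf : Continuous f) : ∃ α, ∀ y, α ≤ h y →
      (∃ c, ∀ z, y ≤ z → ∀ t, f (z, t) ≤ c) ∨
      ((∀ z, y ≤ z → ∀ c, ∃ w, z ≤ w ∧ c < f (w, 1)) ∧
        ∀ c, ∃ δ, ∀ z, y ≤ z → δ ≤ h z → ∀ t, c ≤ f (z, t)) := by
  obtain ⟨Q, hQc, hQd⟩ := TopologicalSpace.exists_countable_dense unitInterval
  have hQ : (insert 1 Q).Countable := hQc.insert 1
  have hQd' : Dense (insert 1 Q) := hQd.mono (subset_insert _ _)
  have := hQ.to_subtype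
  let S := (insert 1 Q : Set unitInterval)
  let B : unitInterval → X → Prop := fun t y => ∃ c, ∀ z, y ≤ z → f (z, t) ≤ c
  have hB : ∀ t y z, y ≤ z → B t y → B t z := fun t y z hyz ⟨c, hc⟩ =>
    ⟨c, fun w hw => hc w (hyz.trans hw)⟩
  -- Boundedness at time `t` on the cone is an upwards closed property, so high nodes decide it.
  -- Restricting to countably many times allows a common level.
  have hdec : ∀ t : unitInterval, ∃ α, ∀ y, α ≤ h y → B t y ∨ ∀ z, y ≤ z → ¬ B t z := fun t => by
    obtain ⟨α, hα⟩ := hT.exists_forall_mem (D := {y | B t y}) fun y hy z hyz => hB t y z hyz hy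
    refine ⟨α, fun y hy => ?_⟩
    by_cases hz : ∃ z, y ≤ z ∧ B t z
    · obtain ⟨z, hyz, hz⟩ := hz
      exact Or.inl (hα y hy ⟨z, hz, hyz⟩)
    · exact Or.inr fun z hyz hBz => hz ⟨z, hyz, hBz⟩
  choose a ha using hdec
  obtain ⟨α, hα⟩ := Omega1.exists_upper fun t : S => a t
  refine ⟨α, fun y hy => ?_⟩
  have hd : ∀ t : S, B t y ∨ ∀ z, y ≤ z → ¬ B t z := fun t => ha t y ((hα t).le.trans hy)
  have hcont : ∀ t, Continuous fun x => f (x, t) := fun t => hf.comp (by fun_prop)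
  have hpath : ∀ z, Continuous fun t => f (z, t) := fun z => hf.comp (by fun_prop)
  have hbd : ∀ t : S, ∃ c, B t y → ∀ z, y ≤ z → f (z, t) ≤ c := fun t => by
    by_cases hBt : B t y
    · exact hBt.imp fun c hc _ => hc
    · exact ⟨Classical.arbitrary _, fun h => absurd h hBt⟩
  choose c₀ hc₀ using hbd
  obtain ⟨c, hc⟩ := LongRay.exists_upper c₀
  have hprop : ∀ d, ∃ δ, ∀ t : S, ¬ B t y → ∀ z, y ≤ z → δ ≤ h z → d ≤ f (z, t) := fun d => by
    have h1 : ∀ t : S, ∃ δ, ¬ B t y → ∀ z, y ≤ z → δ ≤ h z → d ≤ f (z, t) := fun t => by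
      by_cases hBt : B t y
      · exact ⟨h y, fun h => absurd hBt h⟩
      · obtain ⟨δ, hδ⟩ := hT.exists_forall_le_of_unbounded (hcont t) (y := y) (fun z hyz c => by
          have := ((hd t).resolve_left hBt) z hyz
          simp only [B] at this
          push Not at this
          exact this c) d
        exact ⟨δ, fun _ => hδ⟩
    choose δ₀ hδ₀ using h1
    obtain ⟨δ, hδ⟩ := Omega1.exists_upper δ₀
    exact ⟨δ, fun t ht z hyz hz => hδ₀ t ht z hyz ((hδ t).le.trans hz)⟩
  -- all times in `S` are of the same kind
  have hsame : ∀ t t' : S, B t y → ¬ B t' y → False := fun t t' ht ht' => by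
    obtain ⟨d, hcd⟩ := exists_gt c
    obtain ⟨δ, hδ⟩ := hprop d
    obtain ⟨z, hyz, hz⟩ := hT.exists_ge y (max (h y) δ) (le_max_left _ _)
    have hzδ : δ ≤ h z := hz ▸ le_max_right _ _
    have hK : IsClosed {u | f (z, u) ≤ c} := isClosed_Iic.preimage (hpath z)
    have hL : IsClosed {u | d ≤ f (z, u)} := isClosed_Ici.preimage (hpath z)
    -- Times of both kinds would split `[0, 1]` into two disjoint nonempty closed sets along the
    -- path of a high node `z`.
    have hcov : univ ⊆ {u | f (z, u) ≤ c} ∪ {u | d ≤ f (z, u)} := by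
      rw [← hQd'.closure_eq]
      refine closure_minimal (fun u hu => ?_) (hK.union hL)
      by_cases hBu : B u y
      · exact Or.inl ((hc₀ ⟨u, hu⟩ hBu z hyz).trans (hc ⟨u, hu⟩).le)
      · exact Or.inr (hδ ⟨u, hu⟩ hBu z hyz hzδ)
    obtain ⟨u, -, hu1, hu2⟩ := isPreconnected_closed_iff.1 isPreconnected_univ _ _ hK hL hcov
      ⟨t, trivial, (hc₀ t ht z hyz).trans (hc t).le⟩ ⟨t', trivial, hδ t' ht' z hyz hzδ⟩
    exact (hcd.trans_le (le_trans hu2 hu1)).false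
  let one : S := ⟨1, mem_insert _ _⟩
  rcases hd one with h1 | h1
  · refine Or.inl ⟨c, fun z hyz t => ?_⟩
    have hK : IsClosed {u | f (z, u) ≤ c} := isClosed_Iic.preimage (hpath z)
    have : closure S ⊆ {u | f (z, u) ≤ c} := closure_minimal (fun u hu =>
      (hc₀ ⟨u, hu⟩ (by_contra fun h => hsame one ⟨u, hu⟩ h1 h) z hyz).trans (hc ⟨u, hu⟩).le) hK
    exact this (hQd' t)
  · refine Or.inr ⟨fun z hyz c => ?_, fun d => ?_⟩
    · have := h1 z hyz
      simp only [B] at this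
      push Not at this
      exact this c
    · obtain ⟨δ, hδ⟩ := hprop d
      refine ⟨δ, fun z hyz hz t => ?_⟩
      have hL : IsClosed {u | d ≤ f (z, u)} := isClosed_Ici.preimage (hpath z)
      have : closure S ⊆ {u | d ≤ f (z, u)} := closure_minimal (fun u hu =>
        hδ ⟨u, hu⟩ (fun h => hsame ⟨u, hu⟩ one h (h1 y le_rfl)) z hyz hz) hL
      exact this (hQd' t)

theorem homotopyRigid (hT : IsPrunedSuslinTree h) : HomotopyRigid fun α => {x | h x < α} := by
  intro f hf
  obtain ⟨α, hα⟩ := hT.exists_decide hf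
  have hlev := (hT.countable_level α).to_subtype
  refine ⟨fun ⟨c, hc⟩ => ?_, fun hprop c => ?_⟩
  · have h1 : ∀ y : {x | h x = α}, ∃ c, ∀ z, y.1 ≤ z → ∀ t, f (z, t) ≤ c := fun y => by
      rcases hα y y.2.ge with h | ⟨h, -⟩
      · exact h
      · obtain ⟨w, -, hw⟩ := h y le_rfl c
        exact absurd hw (not_lt.2 (hc ⟨w, rfl⟩))
    choose c₁ hc₁ using h1
    obtain ⟨b₁, hb₁⟩ := LongRay.exists_upper c₁
    have := (hT.countable_height_le α).to_subtype
    -- Only countably many nodes lie outside the decided cones, and each has a compact path.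
    have h2 : ∀ x : {x | h x ≤ α}, ∃ c, ∀ t, f (x, t) ≤ c := fun x => by
      obtain ⟨c, hc⟩ := (isCompact_range (f := fun t => f (x, t)) (hf.comp (by fun_prop))).bddAbove
      exact ⟨c, fun t => hc ⟨t, rfl⟩⟩
    choose c₂ hc₂ using h2
    obtain ⟨b₂, hb₂⟩ := LongRay.exists_upper c₂
    refine ⟨max b₁ b₂, ?_⟩
    rintro _ ⟨⟨x, t⟩, rfl⟩
    rcases le_total α (h x) with hx | hx
    · obtain ⟨y, hyx, hy⟩ := hT.exists_le x α hx
      exact ((hc₁ ⟨y, hy⟩ x hyx t).trans (hb₁ _).le).trans (le_max_left _ _)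
    · exact ((hc₂ ⟨x, hx⟩ t).trans (hb₂ _).le).trans (le_max_right _ _)
  · obtain ⟨d, hd⟩ := exists_gt c
    have h1 : ∀ y : {x | h x = α}, ∃ δ, ∀ z, y.1 ≤ z → δ ≤ h z → ∀ t, d ≤ f (z, t) := fun y => by
      rcases hα y y.2.ge with ⟨c', hc'⟩ | ⟨-, h⟩
      -- A cone reaches all heights, so boundedness on it contradicts properness at time 1.
      · obtain ⟨β, hβ⟩ := hprop c'
        obtain ⟨z, hyz, hz⟩ := hT.exists_ge y (max (h y) β) (le_max_left _ _)
        have : h z < β := hβ (hc' z hyz 1)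
        exact absurd (hz ▸ le_max_right (h y) β) this.not_ge
      · exact h d
    choose δ₁ hδ₁ using h1
    obtain ⟨δ, hδ⟩ := Omega1.exists_upper δ₁
    refine ⟨max α δ, fun x ⟨t, ht⟩ => ?_⟩
    by_contra hx
    have hx' : max α δ ≤ h x := not_lt.1 hx
    obtain ⟨y, hyx, hy⟩ := hT.exists_le x α ((le_max_left _ _).trans hx')
    have := hδ₁ ⟨y, hy⟩ x hyx ((hδ _).le.trans ((le_max_right _ _).trans hx')) t
    exact (hd.trans_le (this.trans ht)).false

end IsPrunedSuslinTree

/-! ### `ω₁`-compactness of `Σ(X, s)` over a Suslin tree -/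

theorem IsPrunedSuslinTree.isOmega1Compact_sigmaSpace {X : Type*} [PartialOrder X]
    [TopologicalSpace X] {h : X → Omega1} (hT : IsPrunedSuslinTree h) {s : X → LongRay}
    (hs : IsSlicer (fun α => {x | h x < α}) s) : IsOmega1Compact (SigmaSpace s) := by
  intro D hD hdisc
  have hU := isCanonicalSeq_height hT.isClopen_height_le hT.isLindelof_height_le
  have hseq := SigmaSpace.isTypeISeq_seq hU hs
  have hcyl : Continuous (SigmaSpace.cyl s) := SigmaSpace.continuous_cyl hs.continuous
  have hcore : (SigmaSpace.core ⁻¹' D : Set LongRay).Countable := by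
    refine LongRay.isOmegaBounded.isOmega1Compact _ (hD.preimage SigmaSpace.continuous_core) ?_
    refine DiscreteTopology.of_continuous_injective
      (f := fun x : (SigmaSpace.core ⁻¹' D : Set LongRay) => (⟨SigmaSpace.core x.1, x.2⟩ : D))
      ((SigmaSpace.continuous_core.comp continuous_subtype_val).subtype_mk _) fun x y hxy => ?_
    exact Subtype.ext (SigmaSpace.core_injective (congrArg Subtype.val hxy))
  let T : ℕ → Set unitInterval := fun n => {t | (t : ℝ) ≤ 1 - 1 / (n + 1)}
  have hTc : ∀ n, IsCompact (T n) := fun n =>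
    (isClosed_le continuous_subtype_val continuous_const).isCompact
  have hT1 : ∀ n, ∀ t ∈ T n, (t : ℝ) < 1 := fun n t ht =>
    lt_of_le_of_lt ht (sub_lt_self _ (by positivity))
  let F : Set (X × unitInterval) := SigmaSpace.cyl s ⁻¹' D
  have hF : IsClosed F := hD.preimage hcyl
  -- The trace of `D` on times in the compact set `T n` has closed projection. If this is unbounded,
  -- it contains some `y` together with points strictly below converging to `y`, which discreteness
  -- of `D` and the tube lemma forbid.
  have hbdd : ∀ n, ∃ α, {x | ∃ t ∈ T n, (x, t) ∈ F} ⊆ {x | h x < α} := by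
    intro n
    by_contra! hcon
    have hE : IsClosed {x | ∃ t ∈ T n, (x, t) ∈ F} := hF.exists_mem_of_isCompact (hTc n)
    obtain ⟨x, hx⟩ := hT.exists_dense_above (A := {x | ∃ t ∈ T n, (x, t) ∈ F}) fun α => by
      obtain ⟨z, hz, hz'⟩ := not_subset.1 (hcon α)
      exact ⟨z, hz, not_lt.1 hz'⟩
    obtain ⟨α, hα, hlev⟩ := hT.exists_level_subset (ι := Unit) (fun _ => hE) (fun _ => hx)
    obtain ⟨y, hxy, hy⟩ := hT.exists_ge x α hα
    obtain ⟨hpos, hlim⟩ := hlev y hxy hy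
    have hloc : ∀ t ∈ T n, ∃ W : Set (X × unitInterval), IsOpen W ∧ (y, t) ∈ W ∧
        ∀ p ∈ W, p.2 ∈ T n → p ∈ F → p.1 = y := by
      intro t ht
      by_cases hyt : (y, t) ∈ F
      · obtain ⟨G, hG, hyG, hGD⟩ := exists_isOpen_inter_subset_singleton hdisc
          (a := SigmaSpace.cyl s (y, t)) hyt
        refine ⟨SigmaSpace.cyl s ⁻¹' G, hG.preimage hcyl, hyG, fun p hpG hpT hpF => ?_⟩
        have h1 : SigmaSpace.cyl s p = SigmaSpace.cyl s (y, t) := hGD ⟨hpG, hpF⟩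
        rw [SigmaSpace.cyl_of_lt (hT1 n _ hpT), SigmaSpace.cyl_of_lt (p := (y, t)) (hT1 n t ht)]
          at h1
        exact congrArg Prod.fst (SigmaSpace.body_injective h1)
      · exact ⟨Fᶜ, hF.isOpen_compl, hyt, fun p hp _ hpF => absurd hpF hp⟩
    choose! W hW hyW hWF using hloc
    obtain ⟨u, v, hu, -, hyu, hTv, huv⟩ := generalized_tube_lemma
      (isCompact_singleton (x := y)) (hTc n)
      (isOpen_biUnion fun t (ht : t ∈ T n) => hW t ht) (by
        rintro ⟨y', t⟩ ⟨hy', ht⟩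
        obtain rfl : y' = y := hy'
        exact mem_iUnion₂.2 ⟨t, ht, hyW t ht⟩)
    obtain ⟨β, hβ, hsub⟩ := (hT.isOpen_iff u).1 hu y (hyu rfl) hpos
    obtain ⟨z, ⟨t, ht, hzt⟩, hzy, hβz⟩ := (hlim ()).2 β hβ
    obtain ⟨t', ht', hzW⟩ := mem_iUnion₂.1 (huv (mk_mem_prod (hsub z hzy.le hβz) (hTv ht)))
    exact hzy.ne (hWF t' ht' _ hzW ht hzt)
  choose a ha using hbdd
  obtain ⟨α, hα⟩ := Omega1.exists_upper a
  -- All body points of `D` lie over `{x | h x < α}`, inside a Lindelöf set, where a closed discrete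
  -- set is countable.
  have hcount : (D ∩ closure (SigmaSpace.seq s (fun α => {x | h x < α}) α)).Countable := by
    refine ((hseq.isLindelof_closure α).of_isClosed_subset (hD.inter isClosed_closure)
      inter_subset_right).countable ?_
    exact DiscreteTopology.of_subset hdisc inter_subset_left
  refine ((hcore.image SigmaSpace.core).union hcount).mono fun z hz => ?_
  rcases SigmaSpace.body_or_core z with ⟨p, rfl⟩ | ⟨x, rfl⟩
  · refine Or.inr ⟨hz, subset_closure (SigmaSpace.body_mem_glue.2 ⟨?_, trivial⟩)⟩
    obtain ⟨n, hn⟩ := exists_nat_one_div_lt (sub_pos.2 (mem_Ico.1 p.2.2).2)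
    rw [SigmaSpace.body_eq_cyl] at hz
    have : h p.1 < a n := ha n ⟨⟨p.2, p.2.2.1, p.2.2.2.le⟩,
      (by linarith : (p.2 : ℝ) ≤ 1 - 1 / (n + 1)), hz⟩
    exact this.trans (hα n)
  · exact Or.inl ⟨x, hz, rfl⟩

/-! ### The pruned Hausdorff tree of a Suslin tree -/

namespace IsSuslinTree

variable {T : Type*} [PartialOrder T]

theorem wellFoundedLT (hT : IsSuslinTree T) : WellFoundedLT T := by
  refine ⟨WellFounded.wellFounded_iff_has_min.2 fun S ⟨t, ht⟩ => ?_⟩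
  by_cases hne : (S ∩ Iio t).Nonempty
  · have hwf : (S ∩ Iio t).IsWF := (hT.wf_Iio t).mono inter_subset_right
    refine ⟨hwf.min hne, (hwf.min_mem hne).1, fun x hx hlt => ?_⟩
    exact hwf.not_lt_min hne ⟨hx, hlt.trans (hwf.min_mem hne).2⟩ hlt
  · exact ⟨t, ht, fun x hx hlt => hne ⟨x, hx, hlt⟩⟩

/-- Branches below a node are countable chains, so the rank function can be built by recursion with
values in `ω₁`. -/
theorem exists_height (hT : IsSuslinTree T) :
    ∃ h : T → Omega1, ∀ t, IsLeast {β | ∀ u < t, h u < β} (h t) := by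
  have hub : ∀ (t : T) (r : Iio t → Omega1), ∃ β, IsLeast {β | ∀ i, r i < β} β := fun t r => by
    have := (hT.chain_countable _ (hT.chain_Iio t)).to_subtype
    exact Omega1.exists_isLeast (Omega1.exists_upper r)
  choose m hm using hub
  have hwf := hT.wellFoundedLT.wf
  refine ⟨hwf.fix fun t ih => m t fun i => ih i.1 i.2, fun t => ?_⟩
  rw [hwf.fix_eq _ t]
  have := hm t fun i => hwf.fix (fun t ih => m t fun i => ih i.1 i.2) i.1
  exact ⟨fun u hu => this.1 ⟨u, hu⟩, fun β hβ => this.2 fun i => hβ i.1 i.2⟩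

variable {h : T → Omega1} (hT : IsSuslinTree T) (hh : ∀ t, IsLeast {β | ∀ u < t, h u < β} (h t))

include hh in
theorem height_strictMono : StrictMono h := fun u t hut => (hh t).1 u hut

include hT hh in
theorem exists_lt_height_eq (t : T) : ∀ β < h t, ∃ u < t, h u = β := by
  have := hT.wellFoundedLT
  induction t using WellFoundedLT.induction with
  | ind t ih =>
    intro β hβ
    have : ∃ u < t, β ≤ h u := by
      by_contra! hcon
      exact ((hh t).2 hcon).not_gt hβ
    obtain ⟨u, hut, hβu⟩ := this
    rcases hβu.lt_or_eq with h1 | h1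
    · obtain ⟨v, hv, hvβ⟩ := ih u hut β h1
      exact ⟨v, hv.trans hut, hvβ⟩
    · exact ⟨u, hut, h1.symm⟩

include hT hh in
theorem eq_of_height_eq {u v t : T} (hu : u < t) (hv : v < t) (huv : h u = h v) : u = v := by
  by_contra hne
  have hmono := height_strictMono hh
  rcases hT.chain_Iio t hu hv hne with h1 | h1
  · exact (hmono (h1.lt_of_ne hne)).ne huv
  · exact (hmono (h1.lt_of_ne (Ne.symm hne))).ne huv.symm

include hT hh in
theorem countable_level (α : Omega1) : {t | h t = α}.Countable := by
  refine hT.antichain_countable _ fun p (hp : h p = α) q (hq : h q = α) hne hle => ?_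
  exact (height_strictMono hh (hle.lt_of_ne hne)).ne (hp.trans hq.symm)

include hT hh in
theorem countable_height_lt (α : Omega1) : {t | h t < α}.Countable := by
  refine ((Omega1.countable_Iio α).biUnion fun β _ => hT.countable_level hh β).mono fun x hx => ?_
  exact mem_iUnion₂.2 ⟨h x, hx, rfl⟩

include hT hh in
theorem Iio_subset_of_le_height {t u r : T} (ht : Iio t ⊆ Iio r) (hu : Iio u ⊆ Iio r)
    (htu : h t ≤ h u) : Iio t ⊆ Iio u := fun v hv => by
  obtain ⟨w, hw, hwv⟩ := hT.exists_lt_height_eq hh u (h v) ((height_strictMono hh hv).trans_le htu)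
  exact hT.eq_of_height_eq hh (hu hw) (ht hv) hwv ▸ hw

include hh in
theorem height_le_of_Iio_subset {t u : T} (htu : Iio t ⊆ Iio u) : h t ≤ h u :=
  (hh t).2 fun v hv => (height_strictMono hh (htu hv) : h v < h u)

include hT hh in
theorem Iio_eq_of_subset {t u : T} (htu : Iio t ⊆ Iio u) (heq : h t = h u) : Iio t = Iio u :=
  htu.antisymm (hT.Iio_subset_of_le_height hh subset_rfl htu heq.ge)

include hT hh in
/-- Nodes with uncountable cone have extensions of the same kind at all higher levels. -/
theorem exists_ge_uncountable {t : T} (ht : ¬ (Ici t).Countable) {β : Omega1} (hβ : h t ≤ β) :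
    ∃ u, t ≤ u ∧ ¬ (Ici u).Countable ∧ h u = β := by
  by_contra! hcon
  -- The cone of `t` is covered by the countable part below level `β` and the cones of countably
  -- many nodes of level `β`, so one of these is uncountable.
  refine ht (((hT.countable_height_lt hh β).union (((hT.countable_level hh β).mono
    (s₁ := {u | h u = β ∧ t ≤ u}) fun u hu => hu.1).biUnion
      (t := fun u _ => Ici u) fun u hu => ?_)).mono fun v hv => ?_)
  · by_contra hunc
    exact hcon u hu.2 hunc hu.1
  · rcases lt_or_ge (h v) β with h1 | h1
    · exact Or.inl h1
    · right
      obtain ⟨u, huv, hu⟩ : ∃ u ≤ v, h u = β := by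
        rcases h1.lt_or_eq with h2 | h2
        · obtain ⟨u, hu, hu'⟩ := hT.exists_lt_height_eq hh v β h2
          exact ⟨u, hu.le, hu'⟩
        · exact ⟨v, le_rfl, h2.symm⟩
      refine mem_iUnion₂.2 ⟨u, ⟨hu, ?_⟩, huv⟩
      rcases huv.lt_or_eq with h2 | rfl
      · rcases (mem_Ici.1 hv).lt_or_eq with h3 | rfl
        · by_cases htu : t = u
          · exact htu.le
          · rcases hT.chain_Iio v h3 h2 htu with h4 | h4
            · exact h4
            · exact absurd (height_strictMono hh (h4.lt_of_ne (Ne.symm htu)))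
                (hβ.trans hu.ge).not_gt
        · exact absurd (height_strictMono hh h2) (hβ.trans hu.ge).not_gt
      · exact hv

include hT hh in
theorem exists_uncountable : ∃ t : T, ¬ (Ici t).Countable := by
  by_contra! hcon
  obtain ⟨m, -, hm⟩ := Omega1.exists_isLeast (univ_nonempty (α := Omega1))
  have := hT.uncountable
  refine not_countable_univ (((hT.countable_level hh m).biUnion (t := fun u _ => Ici u)
    fun u _ => hcon u).mono fun v _ => ?_)
  rcases (hm trivial : m ≤ h v).lt_or_eq with h2 | h2
  · obtain ⟨u, hu, hu'⟩ := hT.exists_lt_height_eq hh v m h2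
    exact mem_iUnion₂.2 ⟨u, hu', hu.le⟩
  · exact mem_iUnion₂.2 ⟨v, h2.symm, le_rfl⟩

end IsSuslinTree

/-- The branches `{u | u < t}` of a tree, where `t` has uncountably many successors. -/
def BranchTree (T : Type*) [PartialOrder T] : Type _ :=
  {p : Set T // ∃ t, ¬ (Ici t).Countable ∧ p = Iio t}

namespace BranchTree

variable {T : Type*} [PartialOrder T]

instance : PartialOrder (BranchTree T) :=
  inferInstanceAs (PartialOrder {p : Set T // ∃ t, ¬ (Ici t).Countable ∧ p = Iio t})

/-- A node whose branch is the given one. -/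
noncomputable def rep (p : BranchTree T) : T := p.2.choose

/-- The branch below a node. -/
def mk (t : T) (ht : ¬ (Ici t).Countable) : BranchTree T := ⟨Iio t, t, ht, rfl⟩

theorem rep_uncountable (p : BranchTree T) : ¬ (Ici p.rep).Countable := p.2.choose_spec.1

theorem val_eq (p : BranchTree T) : p.1 = Iio p.rep := p.2.choose_spec.2

theorem Iio_rep_mk (t : T) (ht : ¬ (Ici t).Countable) : Iio (mk t ht).rep = Iio t :=
  (val_eq (mk t ht)).symm

theorem le_iff {p q : BranchTree T} : p ≤ q ↔ Iio p.rep ⊆ Iio q.rep := by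
  rw [← val_eq, ← val_eq]
  rfl

theorem eq_of_Iio_rep {p q : BranchTree T} (h : Iio p.rep = Iio q.rep) : p = q :=
  le_antisymm (le_iff.2 h.subset) (le_iff.2 h.superset)

/-- The tree topology determined by a height function. -/
@[reducible]
def treeTopology {X : Type*} [PartialOrder X] (h : X → Omega1) : TopologicalSpace X where
  IsOpen G := ∀ p ∈ G, (∃ β, β < h p) → ∃ β < h p, ∀ q ≤ p, β < h q → q ∈ G
  isOpen_univ := fun _ _ ⟨β, hβ⟩ => ⟨β, hβ, fun _ _ _ => trivial⟩
  isOpen_inter G H hG hH := fun p ⟨hpG, hpH⟩ hp => by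
    obtain ⟨β, hβ, h1⟩ := hG p hpG hp
    obtain ⟨γ, hγ, h2⟩ := hH p hpH hp
    exact ⟨max β γ, max_lt hβ hγ, fun q hq hlt => ⟨h1 q hq ((le_max_left _ _).trans_lt hlt),
      h2 q hq ((le_max_right _ _).trans_lt hlt)⟩⟩
  isOpen_sUnion S hS := fun p ⟨G, hG, hpG⟩ hp => by
    obtain ⟨β, hβ, h1⟩ := hS G hG p hpG hp
    exact ⟨β, hβ, fun q hq hlt => ⟨G, hG, h1 q hq hlt⟩⟩

/-- Replacing nodes by the branches below them identifies nodes with the same predecessors, which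
gives the Hausdorff condition. Keeping only uncountable cones gives extensions of all heights. -/
theorem isPrunedSuslinTree (hT : IsSuslinTree T) {h : T → Omega1}
    (hh : ∀ t, IsLeast {β | ∀ u < t, h u < β} (h t)) :
    @IsPrunedSuslinTree (BranchTree T) _ (treeTopology fun p => h p.rep) fun p => h p.rep := by
  have hmk : ∀ t ht, h (mk t ht).rep = h t := fun t ht =>
    le_antisymm (IsSuslinTree.height_le_of_Iio_subset hh (Iio_rep_mk t ht).subset)
      (IsSuslinTree.height_le_of_Iio_subset hh (Iio_rep_mk t ht).superset)
  have hmono : StrictMono fun p : BranchTree T => h p.rep := fun p q hpq => by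
    refine (IsSuslinTree.height_le_of_Iio_subset hh (le_iff.1 hpq.le)).lt_of_ne fun heq => ?_
    exact hpq.ne (eq_of_Iio_rep (hT.Iio_eq_of_subset hh (le_iff.1 hpq.le) heq))
  have hle : ∀ p : BranchTree T, ∀ u < p.rep, ∃ hu, mk u hu < p ∧ h (mk u hu).rep = h u := by
    intro p u hu
    have hu' : ¬ (Ici u).Countable := fun hc =>
      p.rep_uncountable (hc.mono (Ici_subset_Ici.2 hu.le))
    refine ⟨hu', lt_of_le_of_ne ?_ ?_, hmk u hu'⟩
    · rw [le_iff, Iio_rep_mk]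
      exact Iio_subset_Iio hu.le
    · intro heq
      have := hmk u hu'
      rw [heq] at this
      exact (IsSuslinTree.height_strictMono hh hu).ne' this
  let := treeTopology fun p : BranchTree T => h p.rep
  refine ⟨?_, fun p q r hp hq => ?_, hmono, fun p β hβ => ?_, fun p β hβ => ?_,
    fun p q hlim heq hpq => ?_, fun A hA => ?_, fun C hC => ?_, fun G => Iff.rfl⟩
  · obtain ⟨t, ht⟩ := hT.exists_uncountable hh
    exact ⟨mk t ht⟩
  · rw [le_iff] at hp hq
    simp only [le_iff]
    exact (le_total (h p.rep) (h q.rep)).imp (hT.Iio_subset_of_le_height hh hp hq)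
      (hT.Iio_subset_of_le_height hh hq hp)
  · rcases hβ.lt_or_eq with h1 | h1
    · obtain ⟨u, hu, rfl⟩ := hT.exists_lt_height_eq hh _ β h1
      obtain ⟨hu', h2, h3⟩ := hle p u hu
      exact ⟨_, h2.le, h3⟩
    · exact ⟨p, le_rfl, h1.symm⟩
  · obtain ⟨u, hpu, hu, rfl⟩ := hT.exists_ge_uncountable hh p.rep_uncountable hβ
    refine ⟨mk u hu, ?_, hmk u hu⟩
    rw [le_iff, Iio_rep_mk]
    exact Iio_subset_Iio hpu
  -- At a limit height, `v` has a successor `w` on the same branch, and the branch below `w`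
  -- contains `v` and is strictly below `p`, hence contained in `q`.
  · refine eq_of_Iio_rep (hT.Iio_eq_of_subset hh (fun v hv => ?_) heq)
    obtain ⟨w, hw, hwv⟩ := hT.exists_lt_height_eq hh _ _
      (hlim.succ_lt (IsSuslinTree.height_strictMono hh hv))
    have hvw : v < w := by
      have hlt : h v < h w := hwv ▸ Order.lt_succ _
      have hne : v ≠ w := fun he => hlt.ne (congrArg h he)
      rcases hT.chain_Iio _ hv hw hne with h1 | h1
      · exact h1.lt_of_ne hne
      · exact absurd (IsSuslinTree.height_strictMono hh (h1.lt_of_ne hne.symm)) hlt.not_gt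
    obtain ⟨hw', h2, -⟩ := hle p w hw
    have h3 := le_iff.1 (hpq _ h2).le
    rw [Iio_rep_mk] at h3
    exact h3 hvw
  · have hinj : Function.Injective (rep : BranchTree T → T) := fun p q hpq =>
      eq_of_Iio_rep (by rw [hpq])
    refine countable_of_injective_of_countable_image hinj.injOn
      (hT.antichain_countable (rep '' A) ?_)
    rintro _ ⟨p, hp, rfl⟩ _ ⟨q, hq, rfl⟩ hne hpq
    exact hA hp hq (fun he => hne (congrArg rep he)) (le_iff.2 (Iio_subset_Iio hpq))
  -- A chain of branches has a chain of `T` as its union; this is countable and bounds the heights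
  -- of the members of `C`.
  · have hchain : IsChain (· ≤ ·) (⋃ p ∈ C, Iio p.rep) := by
      intro v hv w hw hne
      obtain ⟨p, hp, hvp⟩ := mem_iUnion₂.1 hv
      obtain ⟨q, hq, hwq⟩ := mem_iUnion₂.1 hw
      rcases hC.total hp hq with hpq | hpq
      · exact hT.chain_Iio _ (le_iff.1 hpq hvp) hwq hne
      · exact hT.chain_Iio _ hvp (le_iff.1 hpq hwq) hne
    obtain ⟨β, hβ⟩ := exists_upper_of_countable ((hT.chain_countable _ hchain).image h)
    refine countable_of_injective_of_countable_image (f := fun p : BranchTree T => h p.rep)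
      (fun p hp q hq hpq => ?_) ((Omega1.countable_Iic β).mono ?_)
    · by_contra hne
      rcases hC hp hq hne with h1 | h1
      · exact (hmono (h1.lt_of_ne hne)).ne hpq
      · exact (hmono (h1.lt_of_ne (Ne.symm hne))).ne hpq.symm
    · rintro _ ⟨p, hp, rfl⟩
      exact (hh _).2 fun u hu => hβ _ ⟨u, mem_iUnion₂.2 ⟨p, hp, hu⟩, rfl⟩

end BranchTree

/-! ### The space of part (b) -/

theorem exists_sigmaSpace_of_isSuslinTree {T : Type} [PartialOrder T] (hT : IsSuslinTree T) :
    ∃ (X : Type) (_ : TopologicalSpace X) (U : Omega1 → Set X) (s : X → LongRay),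
      IsTypeI X ∧ IsCanonicalSeq U ∧ IsSlicer U s ∧
      IsTypeI (SigmaSpace s) ∧ IsLocallyMetrizable (SigmaSpace s) ∧
      IsLocallySeparable (SigmaSpace s) ∧ IsOmega1Compact (SigmaSpace s) ∧
      IsDirectionInItself (SigmaSpace s) ∧
      ∃ C : Set (SigmaSpace s), IsClubSubset C ∧ ContainsNoDirectionInItself C := by
  obtain ⟨h, hh⟩ := hT.exists_height
  let := BranchTree.treeTopology fun p : BranchTree T => h p.rep
  have hX := BranchTree.isPrunedSuslinTree hT hh
  have hU := isCanonicalSeq_height hX.isClopen_height_le hX.isLindelof_height_le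
  have hs := isSlicer_height hX.isClopen_height_le
  have := hX.t3Space
  have hI := isTypeI_height hX.isClopen_height_le hX.isLindelof_height_le hX.exists_le_height
  exact ⟨BranchTree T, inferInstance, _, _, hI, hU, hs, SigmaSpace.isTypeI hU hs,
    SigmaSpace.isLocallyMetrizable hU hs hX.secondCountableTopology,
    SigmaSpace.isLocallySeparable hU hs hX.secondCountableTopology,
    hX.isOmega1Compact_sigmaSpace hs, SigmaSpace.isDirectionInItself hU hs hX.homotopyRigid,
    SigmaSpace.exists_containsNoDirectionInItself hI hU hs hX.containsNoDirection⟩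

theorem theorem6p9 :
    -- (a)
    (∃ (X : Type) (_ : TopologicalSpace X) (U : Omega1 → Set X) (s : X → LongRay),
      IsTypeI X ∧ IsCanonicalSeq U ∧ IsSlicer U s ∧
      IsTypeI (SigmaSpace s) ∧ IsOmegaBounded (SigmaSpace s) ∧
      IsDirectionInItself (SigmaSpace s) ∧
      ∃ C : Set (SigmaSpace s), IsClubSubset C ∧ ContainsNoDirectionInItself C) ∧
    -- (b)
    (¬ SuslinHypothesis →
      ∃ (X : Type) (_ : TopologicalSpace X) (U : Omega1 → Set X) (s : X → LongRay),
        IsTypeI X ∧ IsCanonicalSeq U ∧ IsSlicer U s ∧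
        IsTypeI (SigmaSpace s) ∧ IsLocallyMetrizable (SigmaSpace s) ∧
        IsLocallySeparable (SigmaSpace s) ∧ IsOmega1Compact (SigmaSpace s) ∧
        IsDirectionInItself (SigmaSpace s) ∧
        ∃ C : Set (SigmaSpace s), IsClubSubset C ∧ ContainsNoDirectionInItself C) ∧
    -- (c)
    (NyikosClaim → DiamondPlus →
      ∃ (X : Type) (_ : TopologicalSpace X) (U : Omega1 → Set X) (s : X → LongRay),
        IsTypeI X ∧ IsCanonicalSeq U ∧ IsSlicer U s ∧
        IsTypeI (SigmaSpace s) ∧ IsLocallyMetrizable (SigmaSpace s) ∧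
        IsLocallySeparable (SigmaSpace s) ∧ IsOmega1Compact (SigmaSpace s) ∧
        IsOmegaBounded (SigmaSpace s) ∧
        IsDirectionInItself (SigmaSpace s) ∧
        ∃ C : Set (SigmaSpace s), IsClubSubset C ∧ ContainsNoDirectionInItself C) := by
  refine ⟨exists_omegaBounded_sigmaSpace, fun hSH => ?_, fun hN hD => ?_⟩
  · obtain ⟨T, _, hT⟩ := not_not.1 hSH
    exact exists_sigmaSpace_of_isSuslinTree hT
  · obtain ⟨N, _, hsurf, hI, hω, hdir⟩ := hN hD
    exact exists_sigmaSpace_of_surface hsurf hI hω hdir
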